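/- **Proposition.** Let $\ell\ge 1$ be an integer and $m\in\mathbb{Z}$. Write $\mathbb{N}=\{0,1,2,\ldots\}$, let $\zeta$ be the Riemann zeta function and $\Gamma$ the gamma function (meromorphically continued to $\mathbb{C}$), and for $t>0$ put \[ Z_m^{[\ell]}(t):=\sum_{\delta_1,\ldots,\delta_\ell=1}^{\infty}\delta_1^{m-1}\,\delta_2^{m-2}\cdots\delta_\ell^{m-\ell}\ e^{-\delta_1\cdots\delta_\ell t}, \] that is, $Z_m^{[\ell]}=Z^{[\ell]}_{m,m-1,\ldots,m-\ell+1}$, where $Z^{[\ell]}_{\alpha_1,\ldots,\alpha_\ell}(t)=\sum_{\delta_1,\ldots,\delta_\ell\ge1}\delta_1^{\alpha_1-1}\cdots\delta_\ell^{\alpha_\ell-1}e^{-\delta_1\cdots\delta_\ell t}$. For $b\in\mathbb{N}$ and $a\in\mathbb{C}$ let \[ \mathscr{C}_{a,b}:=\frac{1}{b!}\sum_{\substack{p,k_1,\ldots,k_\ell\ge 0\\ b+p+k_1+\cdots+k_\ell=\ell}}\big([z^p]\,z\Gamma(-a+z)\big)\prod_{j=1}^{\ell}\big([z^{k_j}]\,z\zeta(-a-m+j+z)\big),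 \] where $[z^k]f(z)$ denotes the coefficient of $z^k$ in the power series expansion of $f$ at $z=0$ (removable singularities being filled in). Let $S_{\ell,m}:=\{-m,-m+1,\ldots,-m+\ell-1\}$. Then the series defining $Z_m^{[\ell]}(t)$ converges absolutely for every $t>0$, and as $t\to0^+$ one has the complete asymptotic expansion \[ Z_m^{[\ell]}(t)\sim\sum_{(a,b)\in(\mathbb{N}\cup S_{\ell,m})\times\{0,1\}}\mathscr{C}_{a,b}\ t^a(-\ln t)^b, \] meaning that, for every integer $N\ge0$, the difference between $Z_m^{[\ell]}(t)$ and the sum of the terms with $a\le N$ is $o(t^N)$. The coefficients are given as follows. * If $a\in\mathbb{N}\setminus S_{\ell,m}$, then, for all $b\in\mathbb{N}$, $\displaystyle \mathscr{C}_{a,b}=\mathbf{1}\{b=0\}\,\frac{(-1)^a}{a!}\prod_{j=1}^{\ell}\zeta(-a-m+j)$. * If $a\in S_{\ell,m}\setminus\mathbb{N}$, then, for all $b\in\mathbb{N}$, $\displaystyle \mathscr{C}_{a,b}=\mathbf{1}\{b=0\}\,(-a-1)!\prod_{\substack{1\le j\le\ell\\ j\ne a+m+1}}\zeta(-a-m+j)$.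 * If $a\in\mathbb{N}\cap S_{\ell,m}$, then $\mathscr{C}_{a,b}=0$ for $b\ge2$, \[ \mathscr{C}_{a,1}=\frac{(-1)^a}{a!}\prod_{\substack{1\le j\le\ell\\ j\ne a+m+1}}\zeta(-a-m+j), \] and \[ \mathscr{C}_{a,0}=\frac{(-1)^a}{a!}\Bigg[\Big(1+\frac12+\cdots+\frac1a\Big)\prod_{\substack{1\le j\le\ell\\ j\ne a+m+1}}\zeta(-a-m+j)+\sum_{\substack{1\le j\le\ell\\ j\ne a+m+1}}\zeta'(-a-m+j)\prod_{\substack{1\le r\le\ell\\ r\notin\{a+m+1,\,j\}}}\zeta(-a-m+r)\Bigg]. \] -/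

import Mathlib

open Filter Topology Asymptotics
open scoped Nat

noncomputable section

namespace MultiZ

/-- The general term `δ₁^(α₁-1) ⋯ δ_ℓ^(α_ℓ-1) e^(-δ₁⋯δ_ℓ t)`, for positive integers `δ_j`. -/
def term {ℓ : ℕ} (α : Fin ℓ → ℂ) (t : ℝ) (δ : Fin ℓ → ℕ+) : ℂ :=
  (∏ j, ((δ j : ℕ) : ℂ) ^ (α j - 1)) * Complex.exp (-(∏ j, ((δ j : ℕ) : ℂ)) * (t : ℂ))

/-- The multiple sum `Z_{α₁,…,α_ℓ}^{[ℓ]}(t)`. -/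
def Z {ℓ : ℕ} (α : Fin ℓ → ℂ) (t : ℝ) : ℂ :=
  ∑' δ : Fin ℓ → ℕ+, term α t δ

/-- `[z^k] f(z)`: the coefficient of `z^k` in the power series at `0` of `f`. The value at `0` is
first replaced by the limit of `f` at `0`, so that a removable singularity at `0` (as for
`z * Γ(-a+z)` and `z * ζ(u+z)`) is filled in, whatever the value assigned to `f 0`. -/
def psCoeff (k : ℕ) (f : ℂ → ℂ) : ℂ :=
  iteratedDeriv k (Function.update f 0 (limUnder (𝓝[≠] (0 : ℂ)) f)) 0 / (k ! : ℂ)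

/-- The coefficient `C_{a,b}^{[ℓ]}(α₁,…,α_ℓ)`. The constraint `b + p + k₁ + ⋯ + k_ℓ = ℓ` on the
nonnegative integers `p, k₁, …, k_ℓ` makes all of them at most `ℓ`. -/
def coeffC {ℓ : ℕ} (α : Fin ℓ → ℂ) (a : ℂ) (b : ℕ) : ℂ :=
  1 / (b ! : ℂ) *
    ∑ p ∈ Finset.range (ℓ + 1),
      ∑ k ∈ Fintype.piFinset (fun _ : Fin ℓ => Finset.range (ℓ + 1)),
        if b + p + ∑ j, k j = ℓ then
          psCoeff p (fun z => z * Complex.Gamma (-a + z)) *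
            ∏ j, psCoeff (k j) (fun z => z * riemannZeta (-a + 1 - α j + z))
        else 0

/-- The staircase `(m, m-1, …, m-ℓ+1)`. -/
def staircase (ℓ : ℕ) (m : ℤ) : Fin ℓ → ℂ :=
  fun j => (m : ℂ) - ((j : ℕ) : ℂ)

/-- The set `S_{ℓ,m} = {-m, -m+1, …, -m+ℓ-1}`. -/
def S (ℓ : ℕ) (m : ℤ) : Finset ℤ :=
  Finset.Icc (-m) (-m + ℓ - 1)

/-- The exponents `a ∈ ℕ ∪ S_{ℓ,m}` with `a ≤ N`. -/
def exponentsUpTo (ℓ : ℕ) (m : ℤ) (N : ℕ) : Finset ℤ :=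
  Finset.Icc (0 : ℤ) N ∪ {a ∈ S ℓ m | a ≤ (N : ℤ)}

/-- The index set `{1, …, ℓ} ∖ {a+m+1}`. -/
def regularIdx (ℓ : ℕ) (m a : ℤ) : Finset ℤ :=
  (Finset.Icc (1 : ℤ) ℓ).erase (a + m + 1)

end MultiZ

end

/-! The proof is the Mellin transform method. For large real part of `s` the Mellin transform of `Z
α` is `Γ(s) ∏ ζ(s + 1 - α j)` (`mellinZ`), because summing over the `δ j` factorizes the Dirichlet
series. Conversely `hasSum_term` recovers `Z α` as an inverse Mellin transform on a line to the
right of all poles, and this also gives absolute convergence.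

The line is then moved to real part `-(N + 1/2)`. A pole at `-a` with principal part `C₁/(s+a)² +
C₀/(s+a)` contributes `t^a (C₀ - C₁ log t)`, and the shifted integral is `O(t^(N+1/2))`. For the
staircase the numbers `α j` are distinct, so at each pole at most one zeta factor is singular;
together with gamma the order is at most two. No residue theorem is used: the principal parts are
subtracted, the difference is holomorphic after removable singularities are filled in, Cauchy's
theorem on rectangles moves the line, and the principal parts are inverted explicitly
(`exists_mellinInv_remainder`).

Moving the line needs decay on vertical strips. Zeta grows at most polynomially there
(`polyBddOn_riemannZeta`), by a recursion expressing `ζ(s)` through `ζ(s+1), ζ(s+2), …`; gamma beats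
every polynomial by its functional equation (`PolyBddOn.norm_Gamma_mul_le`).

The coefficients are found algebraically. `coeffC` is a coefficient of a product of power series
(`coeffC_eq`), in which each factor regular at `-a` supplies one `X` and each singular factor none.
The two-term expansions `exists_Gamma_jet` and `exists_zeta_jet` then suffice; the harmonic number
comes from gamma, and Euler's constant cancels between gamma and zeta. -/

namespace MultiZ

/-! ### Landau's recursion for the zeta function -/

/-- The generalized binomial coefficient `w (w-1) ⋯ (w-k+1) / k!`. -/
noncomputable def binom (k : ℕ) (w : ℂ) : ℂ := (∏ i ∈ Finset.range k, (w - i)) / (k ! : ℂ)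

/-- The remainder of the Taylor polynomial of degree `< K` of `x ↦ (y + x) ^ w` at `0`. -/
noncomputable def powRem (K : ℕ) (w : ℂ) (y x : ℝ) : ℂ :=
  ((y + x : ℝ) : ℂ) ^ w - ∑ k ∈ Finset.range K, binom k w * (y : ℂ) ^ (w - k) * (x : ℂ) ^ k

lemma binom_zero (w : ℂ) : binom 0 w = 1 := by simp [binom]

lemma prod_range_succ_sub (k : ℕ) (w : ℂ) :
    ∏ i ∈ Finset.range (k + 1), (w - i) = w * ∏ i ∈ Finset.range k, (w - 1 - i) := by
  rw [Finset.prod_range_succ', mul_comm]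
  simp only [Nat.cast_zero, sub_zero, Nat.cast_add, Nat.cast_one]
  congr 1
  exact Finset.prod_congr rfl fun i _ => by ring

lemma binom_succ_mul (k : ℕ) (w : ℂ) : binom (k + 1) w * (k + 1) = w * binom k (w - 1) := by
  have h1 : ((k : ℂ) + 1) ≠ 0 := by exact_mod_cast Nat.succ_ne_zero k
  have h2 : ((k ! : ℕ) : ℂ) ≠ 0 := by exact_mod_cast Nat.factorial_ne_zero k
  rw [binom, binom, prod_range_succ_sub, Nat.factorial_succ]
  push_cast
  field_simp

lemma hasDerivAt_powRem (K : ℕ) (w : ℂ) {y x : ℝ} (h : 0 < y + x) :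
    HasDerivAt (powRem (K + 1) w y) (w * powRem K (w - 1) y x) x := by
  have h1 : HasDerivAt (fun x : ℝ => ((y + x : ℝ) : ℂ) ^ w) (w * ((y + x : ℝ) : ℂ) ^ (w - 1)) x := by
    have h2 : HasDerivAt (fun z : ℂ => ((y : ℂ) + z) ^ w) (w * ((y : ℂ) + x) ^ (w - 1) * 1) (x : ℂ) := by
      refine HasDerivAt.cpow_const ((hasDerivAt_id _).const_add _) ?_
      left
      simpa using h
    simpa using h2.comp_ofReal
  have h3 : HasDerivAt (fun x : ℝ => ∑ k ∈ Finset.range (K + 1),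
      binom k w * (y : ℂ) ^ (w - k) * (x : ℂ) ^ k)
      (∑ k ∈ Finset.range (K + 1), binom k w * (y : ℂ) ^ (w - k) * (k * (x : ℂ) ^ (k - 1))) x := by
    refine HasDerivAt.fun_sum fun k _ => HasDerivAt.const_mul _ ?_
    exact (hasDerivAt_pow k (x : ℂ)).comp_ofReal
  refine (h1.sub h3).congr_deriv ?_
  rw [powRem, mul_sub, Finset.sum_range_succ', Finset.mul_sum]
  simp only [Nat.cast_zero, zero_mul, mul_zero, add_zero]
  congr 1
  refine Finset.sum_congr rfl fun k _ => ?_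
  have := binom_succ_mul k w
  push_cast
  rw [show w - (k + 1 : ℂ) = w - 1 - k by ring]
  linear_combination (y : ℂ) ^ (w - 1 - k) * (x : ℂ) ^ k * this

/-- Induction on `K` by the mean value inequality on `[0, 1]`: up to the factor `w`, the derivative
of the remainder is the remainder of one order less for `w - 1`. At order zero, `w.re ≤ 0` makes the
power largest at `x = 0`. -/
lemma norm_powRem_le (K : ℕ) {y : ℝ} (hy : 0 < y) : ∀ (w : ℂ) {x : ℝ}, w.re ≤ K → 0 ≤ x → x ≤ 1 →
    ‖powRem K w y x‖ ≤ ‖∏ i ∈ Finset.range K, (w - i)‖ * y ^ (w.re - K) := by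
  induction K with
  | zero =>
    intro w x hw h0 h1
    have : 0 < y + x := by linarith
    simp only [powRem, Finset.range_zero, Finset.sum_empty, sub_zero, Finset.prod_empty, norm_one,
      one_mul, Nat.cast_zero]
    rw [Complex.norm_cpow_eq_rpow_re_of_pos this]
    exact Real.rpow_le_rpow_of_nonpos hy (by linarith) (by simpa using hw)
  | succ K ih =>
    intro w x hw h0 h1
    set C := ‖∏ i ∈ Finset.range (K + 1), (w - i)‖ * y ^ (w.re - (K + 1 : ℕ)) with hC
    have hd : ∀ u ∈ Set.Icc (0 : ℝ) 1, HasDerivWithinAt (powRem (K + 1) w y)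
        (w * powRem K (w - 1) y u) (Set.Icc 0 1) u := fun u hu =>
      (hasDerivAt_powRem K w (by linarith [hu.1])).hasDerivWithinAt
    have hb : ∀ u ∈ Set.Icc (0 : ℝ) 1, ‖w * powRem K (w - 1) y u‖ ≤ C := by
      intro u hu
      have := ih (w - 1) (x := u) (by push_cast at hw; simp; linarith) hu.1 hu.2
      rw [hC, prod_range_succ_sub, norm_mul, norm_mul, mul_assoc]
      refine mul_le_mul_of_nonneg_left (this.trans (le_of_eq ?_)) (norm_nonneg _)
      congr 2
      simp
      ring
    have h := Convex.norm_image_sub_le_of_norm_hasDerivWithin_le hd hb (convex_Icc _ _)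
      (Set.left_mem_Icc.2 zero_le_one) (show x ∈ Set.Icc (0 : ℝ) 1 from ⟨h0, h1⟩)
    have hz : powRem (K + 1) w y 0 = 0 := by
      rw [powRem, Finset.sum_range_succ']
      simp [binom_zero]
    rw [hz, sub_zero, sub_zero, Real.norm_of_nonneg h0] at h
    refine h.trans (mul_le_of_le_one_right ?_ h1)
    rw [hC]; positivity

lemma powRem_one_eq (K : ℕ) (s : ℂ) (y : ℝ) :
    powRem (K + 1) (1 - s) y 1 = ((y + 1 : ℝ) : ℂ) ^ (1 - s) - (y : ℂ) ^ (1 - s) -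
      ∑ k ∈ Finset.range K, binom (k + 1) (1 - s) * (1 / (y : ℂ) ^ (s + k)) := by
  rw [powRem, Finset.sum_range_succ']
  simp only [binom_zero, Nat.cast_zero, sub_zero, pow_zero, mul_one, one_mul, Complex.ofReal_one,
    one_pow]
  rw [sub_sub, add_comm (Finset.sum _ _)]
  congr 2
  refine Finset.sum_congr rfl fun k _ => ?_
  rw [one_div, ← Complex.cpow_neg]
  congr 2
  push_cast
  ring

lemma hasSum_zeta {s : ℂ} (hs : 1 < s.re) :
    HasSum (fun n : ℕ => 1 / ((n + 1 : ℝ) : ℂ) ^ s) (riemannZeta s) := by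
  have h1 : Summable (fun n : ℕ => 1 / (n : ℂ) ^ s) := Complex.summable_one_div_nat_cpow.2 hs
  have h2 := h1.hasSum
  rw [← zeta_eq_tsum_one_div_nat_cpow hs, ← hasSum_nat_add_iff' 1] at h2
  have h0 : s ≠ 0 := by rintro rfl; simp at hs; linarith
  simpa [h0] using h2

lemma hasSum_telescope {s : ℂ} (hs : 1 < s.re) :
    HasSum (fun n : ℕ => (((n + 1 : ℝ) + 1 : ℝ) : ℂ) ^ (1 - s) - ((n + 1 : ℝ) : ℂ) ^ (1 - s)) (-1) := by
  have ht : Tendsto (fun n : ℕ => ((n + 1 : ℝ) : ℂ) ^ (1 - s)) atTop (𝓝 0) := by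
    rw [tendsto_zero_iff_norm_tendsto_zero]
    have : ∀ n : ℕ, ‖((n + 1 : ℝ) : ℂ) ^ (1 - s)‖ = (n + 1 : ℝ) ^ (-(s.re - 1)) := by
      intro n
      rw [Complex.norm_cpow_eq_rpow_re_of_pos (by positivity)]
      simp
    simp_rw [this]
    have h := (tendsto_rpow_neg_atTop (show 0 < s.re - 1 by linarith)).comp
      (tendsto_natCast_atTop_atTop (R := ℝ))
    have h' := h.comp (tendsto_add_atTop_nat 1)
    refine h'.congr fun n => ?_
    simp
  have hsum : Summable
      (fun n : ℕ => (((n + 1 : ℝ) + 1 : ℝ) : ℂ) ^ (1 - s) - ((n + 1 : ℝ) : ℂ) ^ (1 - s)) := by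
    have hb : ∀ n : ℕ, ‖(((n + 1 : ℝ) + 1 : ℝ) : ℂ) ^ (1 - s) - ((n + 1 : ℝ) : ℂ) ^ (1 - s)‖
        ≤ ‖1 - s‖ * (1 / (n + 1 : ℝ) ^ s.re) := by
      intro n
      have h := norm_powRem_le 1 (show (0 : ℝ) < n + 1 by positivity) (1 - s) (x := 1)
        (by simp; linarith) zero_le_one le_rfl
      rw [powRem_one_eq 0] at h
      simp only [Finset.range_zero, Finset.sum_empty, sub_zero, Finset.range_one,
        Finset.prod_singleton, Nat.cast_zero, Complex.sub_re, Complex.one_re, Nat.cast_one] at h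
      rw [one_div, ← Real.rpow_neg (by positivity)]
      convert h using 3
      ring
    refine Summable.of_norm_bounded (Summable.mul_left _ ?_) hb
    have := (summable_nat_add_iff 1).2 (Real.summable_one_div_nat_rpow.2 hs)
    simpa using this
  refine (hsum.hasSum_iff_tendsto_nat).2 ?_
  have := ht.sub_const 1
  rw [zero_sub] at this
  refine this.congr fun n => ?_
  have := Finset.sum_range_sub (fun n : ℕ => ((n + 1 : ℝ) : ℂ) ^ (1 - s)) n
  simp only [Nat.cast_zero, zero_add, Complex.ofReal_one, Complex.one_cpow] at this
  rw [← this]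
  push_cast
  rfl

/-- Expand each term of the telescoping series for `n^(1-s)` by Taylor's formula. Summed over `n`,
the degree `k + 1` terms give `ζ(s + k)`; the remainders, of size `n^(-Re s - K)`, converge in a
larger half plane. -/
lemma landau_of_one_lt_re (K : ℕ) {s : ℂ} (hs : 1 < s.re) :
    ∑ k ∈ Finset.range K, binom (k + 1) (1 - s) * riemannZeta (s + k) +
      ∑' n : ℕ, powRem (K + 1) (1 - s) (n + 1) 1 = -1 := by
  have h1 := (hasSum_telescope hs).sub (hasSum_sum (s := Finset.range K) fun k _ =>
    (hasSum_zeta (s := s + k) (by simp; linarith [(Nat.cast_nonneg k : (0 : ℝ) ≤ k)])).mul_left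
      (binom (k + 1) (1 - s)))
  have h2 : HasSum (fun n : ℕ => powRem (K + 1) (1 - s) (n + 1) 1)
    (-1 - ∑ k ∈ Finset.range K, binom (k + 1) (1 - s) * riemannZeta (s + k)) := by
    refine h1.congr_fun fun n => ?_
    rw [powRem_one_eq]
  rw [h2.tsum_eq]
  ring

lemma differentiable_binom (k : ℕ) : Differentiable ℂ (binom k) := by
  unfold binom; fun_prop

lemma differentiable_powRem (K : ℕ) {y x : ℝ} (hy : 0 < y) (hx : 0 ≤ x) :
    Differentiable ℂ (fun w => powRem K w y x) := by
  have h1 : ((y + x : ℝ) : ℂ) ≠ 0 := by exact_mod_cast (by linarith : y + x ≠ 0)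
  have h2 : (y : ℂ) ≠ 0 := by exact_mod_cast hy.ne'
  unfold powRem
  refine Differentiable.sub (fun w => ?_) (Differentiable.fun_sum fun k _ => Differentiable.mul
    ((differentiable_binom k).mul fun w => ?_) (differentiable_const _))
  · exact (differentiableAt_id).const_cpow (Or.inl h1)
  · exact (differentiableAt_id.sub_const _).const_cpow (Or.inl h2)

/-- Landau's recursion for the zeta function, in a half plane above or below the real axis. -/
lemma landau (k : ℕ) {ε : ℝ} {s : ℂ} (hs : -(k : ℝ) < s.re) (hε : 0 < ε * s.im) :
    ∑ j ∈ Finset.range (k + 2), binom (j + 1) (1 - s) * riemannZeta (s + j) +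
      ∑' n : ℕ, powRem (k + 3) (1 - s) (n + 1) 1 = -1 := by
  have hε0 : ε ≠ 0 := by rintro rfl; simp at hε
  obtain ⟨M, hM⟩ : ∃ M : ℝ, ‖s‖ < M ∧ 3 + ‖ε‖ < M :=
    ⟨max ‖s‖ (3 + ‖ε‖) + 1, by linarith [le_max_left ‖s‖ (3 + ‖ε‖)],
      by linarith [le_max_right ‖s‖ (3 + ‖ε‖)]⟩
  -- The side of the real axis fixed by the sign of `ε` keeps `U` convex and away from the poles of
  -- every `ζ(z + j)`. The ball gives a uniform bound for the polynomial factor of the remainder.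
  let U : Set ℂ := {z | -(k : ℝ) < z.re} ∩ {z | 0 < ε * z.im} ∩ Metric.ball 0 M
  have hUo : IsOpen U := by
    refine ((isOpen_lt (by fun_prop) (by fun_prop)).inter
      (isOpen_lt (by fun_prop) (by fun_prop))).inter Metric.isOpen_ball
  have hUc : Convex ℝ U := by
    refine ((convex_halfSpace_re_gt _).inter ?_).inter (convex_ball _ _)
    have : IsLinearMap ℝ (fun z : ℂ => ε * z.im) :=
      ⟨fun x y => by simp; ring, fun c x => by simp; ring⟩
    exact convex_halfSpace_gt this 0
  have hd1 : ∀ z ∈ U, ∀ j : ℕ, DifferentiableAt ℂ (fun z => riemannZeta (z + j)) z := by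
    intro z hz j
    have : z + j ≠ 1 := by
      intro h
      have := congrArg Complex.im h
      simp at this
      have h2 := hz.1.2
      simp [this] at h2
    exact (differentiableAt_riemannZeta this).comp z (by fun_prop : DifferentiableAt ℂ (fun z : ℂ => z + j) z)
  have hb : ∃ B : ℝ, ∀ z ∈ U, ‖∏ i ∈ Finset.range (k + 3), (1 - z - i)‖ ≤ B := by
    obtain ⟨B, hB⟩ := (isCompact_closedBall (0 : ℂ) M).exists_bound_of_continuousOn
      (f := fun z => ∏ i ∈ Finset.range (k + 3), (1 - z - i)) (by fun_prop)
    exact ⟨B, fun z hz => hB z (Metric.ball_subset_closedBall hz.2)⟩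
  obtain ⟨B, hB⟩ := hb
  have hd2 : DifferentiableOn ℂ (fun z => ∑' n : ℕ, powRem (k + 3) (1 - z) (n + 1) 1) U := by
    refine Complex.differentiableOn_tsum_of_summable_norm
      (u := fun n : ℕ => B * (1 / ((n + 1 : ℕ) : ℝ) ^ (2 : ℕ))) (Summable.mul_left _ ?_) ?_ hUo ?_
    · exact (summable_nat_add_iff 1).2 (Real.summable_one_div_nat_pow.2 one_lt_two)
    · intro n
      exact ((differentiable_powRem (k + 3) (by positivity) zero_le_one).comp
        (by fun_prop : Differentiable ℂ fun z : ℂ => 1 - z)).differentiableOn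
    · intro n z hz
      have hzre : -(k : ℝ) < z.re := hz.1.1
      have h := norm_powRem_le (k + 3) (show (0 : ℝ) < n + 1 by positivity) (1 - z) (x := 1)
        (by simp; linarith) zero_le_one le_rfl
      refine h.trans (mul_le_mul (hB z hz) ?_ (by positivity) ((norm_nonneg _).trans (hB z hz)))
      rw [one_div, ← Real.rpow_natCast, ← Real.rpow_neg (by positivity)]
      push_cast
      refine Real.rpow_le_rpow_of_exponent_le (by linarith [(Nat.cast_nonneg n : (0 : ℝ) ≤ n)]) ?_
      simp; linarith
  have hd3 : DifferentiableOn ℂ (fun z => ∑ j ∈ Finset.range (k + 2),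
      binom (j + 1) (1 - z) * riemannZeta (z + j) +
      ∑' n : ℕ, powRem (k + 3) (1 - z) (n + 1) 1) U := by
    refine DifferentiableOn.add (fun z hz => ?_) hd2
    refine DifferentiableWithinAt.fun_sum fun j _ => ?_
    refine DifferentiableWithinAt.mul ?_ (hd1 z hz j).differentiableWithinAt
    exact ((differentiable_binom (j + 1)).comp
      (by fun_prop : Differentiable ℂ fun z : ℂ => 1 - z)).differentiableAt.differentiableWithinAt
  have hsgn : 0 < ε * SignType.sign ε ∧ ‖((SignType.sign ε : ℝ) : ℂ)‖ ≤ 1 := by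
    rcases lt_or_gt_of_ne hε0 with h | h <;> simp [h]
  -- The point `2 ± i` on the chosen side: near it the identity is already known from the convergent
  -- series, and the identity theorem carries it to all of `U`.
  set z₀ : ℂ := 2 + (SignType.sign ε : ℝ) * Complex.I with hz₀
  have hz₀U : z₀ ∈ U := by
    refine ⟨⟨?_, ?_⟩, ?_⟩
    · simp [hz₀]; linarith [(Nat.cast_nonneg k : (0 : ℝ) ≤ k)]
    · simpa [hz₀] using hsgn.1
    · rw [mem_ball_zero_iff]
      calc ‖z₀‖ ≤ ‖(2 : ℂ)‖ + ‖((SignType.sign ε : ℝ) : ℂ) * Complex.I‖ := norm_add_le _ _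
        _ ≤ 3 := by rw [norm_mul]; rw [Complex.norm_I, mul_one, Complex.norm_ofNat]; linarith [hsgn.2]
        _ < M := by linarith [norm_nonneg ε]
  have hev : (fun z => ∑ j ∈ Finset.range (k + 2),
      binom (j + 1) (1 - z) * riemannZeta (z + j) +
      ∑' n : ℕ, powRem (k + 3) (1 - z) (n + 1) 1) =ᶠ[𝓝 z₀] fun _ => -1 := by
    have : {z : ℂ | 1 < z.re} ∈ 𝓝 z₀ :=
      (isOpen_lt (by fun_prop) (by fun_prop)).mem_nhds (by simp [hz₀])
    filter_upwards [this] with z hz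
    exact landau_of_one_lt_re (k + 2) hz
  exact AnalyticOnNhd.eqOn_of_preconnected_of_eventuallyEq (hd3.analyticOnNhd hUo)
    analyticOnNhd_const hUc.isPreconnected hz₀U hev
    (show s ∈ U from ⟨⟨hs, hε⟩, by simpa using hM.1⟩)

/-! ### Polynomial growth of zeta on vertical strips -/

/-- `f` is bounded on `S` by a constant multiple of a power of `‖s‖`. -/
def PolyBddOn (f : ℂ → ℂ) (S : Set ℂ) : Prop :=
  ∃ A : ℕ, ∃ C : ℝ, 0 ≤ C ∧ ∀ s ∈ S, ‖f s‖ ≤ C * ‖s‖ ^ A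

namespace PolyBddOn

variable {f g : ℂ → ℂ} {S T : Set ℂ}

lemma congr (hf : PolyBddOn f S) (h : ∀ s ∈ S, ‖g s‖ ≤ ‖f s‖) : PolyBddOn g S := by
  obtain ⟨A, C, hC, hf⟩ := hf
  exact ⟨A, C, hC, fun s hs => (h s hs).trans (hf s hs)⟩

lemma of_bound (C : ℝ) (h : ∀ s ∈ S, ‖f s‖ ≤ C) : PolyBddOn f S :=
  ⟨0, max C 0, le_max_right _ _, fun s hs => by simpa using Or.inl (h s hs)⟩

lemma const (c : ℂ) : PolyBddOn (fun _ => c) S := of_bound ‖c‖ fun _ _ => le_rfl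

lemma id : PolyBddOn (fun s => s) S := ⟨1, 1, zero_le_one, fun s _ => by simp⟩

lemma mul (hf : PolyBddOn f S) (hg : PolyBddOn g S) : PolyBddOn (fun s => f s * g s) S := by
  obtain ⟨A, C, hC, hf⟩ := hf
  obtain ⟨B, D, hD, hg⟩ := hg
  refine ⟨A + B, C * D, by positivity, fun s hs => ?_⟩
  rw [norm_mul, pow_add, mul_mul_mul_comm]
  exact mul_le_mul (hf s hs) (hg s hs) (norm_nonneg _) (by positivity)

lemma add (hS : ∀ s ∈ S, 1 ≤ ‖s‖) (hf : PolyBddOn f S) (hg : PolyBddOn g S) :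
    PolyBddOn (fun s => f s + g s) S := by
  obtain ⟨A, C, hC, hf⟩ := hf
  obtain ⟨B, D, hD, hg⟩ := hg
  refine ⟨A + B, C + D, by positivity, fun s hs => ?_⟩
  have h1 : ‖s‖ ^ A ≤ ‖s‖ ^ (A + B) := pow_le_pow_right₀ (hS s hs) (by omega)
  have h2 : ‖s‖ ^ B ≤ ‖s‖ ^ (A + B) := pow_le_pow_right₀ (hS s hs) (by omega)
  calc ‖f s + g s‖ ≤ ‖f s‖ + ‖g s‖ := norm_add_le _ _
    _ ≤ C * ‖s‖ ^ A + D * ‖s‖ ^ B := add_le_add (hf s hs) (hg s hs)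
    _ ≤ C * ‖s‖ ^ (A + B) + D * ‖s‖ ^ (A + B) := by gcongr
    _ = _ := by ring

lemma sum {ι : Type*} (u : Finset ι) {F : ι → ℂ → ℂ} (hS : ∀ s ∈ S, 1 ≤ ‖s‖)
    (h : ∀ i ∈ u, PolyBddOn (F i) S) : PolyBddOn (fun s => ∑ i ∈ u, F i s) S := by
  classical
  induction u using Finset.induction_on with
  | empty => exact of_bound 0 (by simp)
  | insert i u hi ih =>
    simp_rw [Finset.sum_insert hi]
    exact add hS (h i (Finset.mem_insert_self _ _))
      (ih fun j hj => h j (Finset.mem_insert_of_mem hj))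

lemma prod {ι : Type*} (u : Finset ι) {F : ι → ℂ → ℂ}
    (h : ∀ i ∈ u, PolyBddOn (F i) S) : PolyBddOn (fun s => ∏ i ∈ u, F i s) S := by
  classical
  induction u using Finset.induction_on with
  | empty => exact of_bound 1 (by simp)
  | insert i u hi ih =>
    simp_rw [Finset.prod_insert hi]
    exact mul (h i (Finset.mem_insert_self _ _))
      (ih fun j hj => h j (Finset.mem_insert_of_mem hj))

lemma comp_add (hS : ∀ s ∈ S, 1 ≤ ‖s‖) (hf : PolyBddOn f T) (c : ℂ) (h : ∀ s ∈ S, s + c ∈ T) :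
    PolyBddOn (fun s => f (s + c)) S := by
  obtain ⟨A, C, hC, hf⟩ := hf
  refine ⟨A, C * (1 + ‖c‖) ^ A, by positivity, fun s hs => (hf _ (h s hs)).trans ?_⟩
  rw [mul_assoc, ← mul_pow]
  gcongr
  have := hS s hs
  calc ‖s + c‖ ≤ ‖s‖ + ‖c‖ := norm_add_le _ _
    _ ≤ (1 + ‖c‖) * ‖s‖ := by nlinarith [norm_nonneg c]

end PolyBddOn

lemma one_le_norm_of_one_le_abs_im {s : ℂ} (h : 1 ≤ |s.im|) : 1 ≤ ‖s‖ :=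
  h.trans (Complex.abs_im_le_norm s)

lemma polyBddOn_one_sub {S : Set ℂ} (hS : ∀ s ∈ S, 1 ≤ ‖s‖) (c : ℂ) :
    PolyBddOn (fun s => 1 - s - c) S := by
  refine (PolyBddOn.add hS PolyBddOn.id
    (PolyBddOn.const (c - 1))).congr fun s _ => ?_
  rw [← norm_neg]
  apply le_of_eq
  congr 1
  ring_nf

lemma polyBddOn_prod_one_sub {S : Set ℂ} (hS : ∀ s ∈ S, 1 ≤ ‖s‖) (k : ℕ) :
    PolyBddOn (fun s => ∏ i ∈ Finset.range k, (1 - s - (i : ℂ))) S :=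
  PolyBddOn.prod (F := fun (i : ℕ) s => 1 - s - (i : ℂ)) _ fun i _ => polyBddOn_one_sub hS i

lemma polyBddOn_binom {S : Set ℂ} (hS : ∀ s ∈ S, 1 ≤ ‖s‖) (k : ℕ) :
    PolyBddOn (fun s => binom k (1 - s)) S := by
  unfold binom
  simp_rw [div_eq_mul_inv]
  exact (polyBddOn_prod_one_sub hS k).mul (PolyBddOn.const _)

/-- Induction on half planes, moving left by one unit each time. For real part at least 2 the series
bounds zeta. In the step, `landau` expresses `(1 - s) ζ(s)` through values `ζ(s + j + 1)` in the
previous half plane and a polynomially bounded remainder; dividing by `1 - s` is harmless since its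
modulus is at least 1. -/
lemma polyBddOn_riemannZeta (k : ℕ) :
    PolyBddOn riemannZeta {s | 2 - (k : ℝ) ≤ s.re ∧ 1 ≤ |s.im|} := by
  induction k with
  | zero =>
    have hsum := (hasSum_zeta (s := 2) (by norm_num)).summable.norm
    refine PolyBddOn.of_bound (∑' n : ℕ, ‖1 / ((n + 1 : ℝ) : ℂ) ^ (2 : ℂ)‖) fun s hs => ?_
    have hre : 2 ≤ s.re := by simpa using hs.1
    have h := hasSum_zeta (s := s) (by linarith)
    rw [← h.tsum_eq]
    refine tsum_of_norm_bounded hsum.hasSum fun n => ?_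
    have hn : (1 : ℝ) ≤ n + 1 := by linarith [(Nat.cast_nonneg n : (0 : ℝ) ≤ n)]
    rw [norm_div, norm_div, Complex.norm_cpow_eq_rpow_re_of_pos (by linarith),
      Complex.norm_cpow_eq_rpow_re_of_pos (by linarith)]
    simp only [norm_one]
    exact one_div_le_one_div_of_le (by positivity) (Real.rpow_le_rpow_of_exponent_le hn hre)
  | succ k ih =>
    set S : Set ℂ := {s | 2 - ((k + 1 : ℕ) : ℝ) ≤ s.re ∧ 1 ≤ |s.im|}
    have hS : ∀ s ∈ S, 1 ≤ ‖s‖ := fun s hs => one_le_norm_of_one_le_abs_im hs.2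
    have h1 : PolyBddOn (fun s => ∑ j ∈ Finset.range (k + 1),
        binom (j + 2) (1 - s) * riemannZeta (s + (j + 1 : ℕ))) S := by
      refine PolyBddOn.sum
        (F := fun j s => binom (j + 2) (1 - s) * riemannZeta (s + (j + 1 : ℕ))) _ hS fun j _ => (polyBddOn_binom hS _).mul
        (ih.comp_add hS _ fun s hs => ⟨?_, ?_⟩)
      · have := hs.1
        push_cast at this ⊢
        simp
        linarith [(Nat.cast_nonneg j : (0 : ℝ) ≤ j)]
      · simpa using hs.2
    have h2 : PolyBddOn (fun s => ∑' n : ℕ, powRem (k + 3) (1 - s) (n + 1) 1) S := by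
      have hsum : Summable fun n : ℕ => 1 / ((n + 1 : ℕ) : ℝ) ^ (2 : ℕ) :=
        (summable_nat_add_iff 1).2 (Real.summable_one_div_nat_pow.2 one_lt_two)
      have h3 : PolyBddOn (fun s => (∏ i ∈ Finset.range (k + 3), (1 - s - i)) *
          ((∑' n : ℕ, 1 / ((n + 1 : ℕ) : ℝ) ^ (2 : ℕ) : ℝ) : ℂ)) S :=
        (polyBddOn_prod_one_sub hS (k + 3)).mul (PolyBddOn.const _)
      refine h3.congr fun s hs => ?_
      rw [norm_mul, Complex.norm_real, Real.norm_of_nonneg (tsum_nonneg fun n => by positivity)]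
      refine tsum_of_norm_bounded (hsum.hasSum.mul_left _) fun n => ?_
      have hs1 := hs.1
      push_cast at hs1
      have h := norm_powRem_le (k + 3) (show (0 : ℝ) < n + 1 by positivity) (1 - s) (x := 1)
        (by simp; linarith) zero_le_one le_rfl
      refine h.trans (mul_le_mul_of_nonneg_left ?_ (norm_nonneg _))
      rw [one_div, ← Real.rpow_natCast, ← Real.rpow_neg (by positivity)]
      push_cast
      refine Real.rpow_le_rpow_of_exponent_le (by linarith [(Nat.cast_nonneg n : (0 : ℝ) ≤ n)]) ?_
      simp; linarith
    refine (PolyBddOn.add hS (PolyBddOn.add hS h1 h2)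
      (PolyBddOn.const 1)).congr fun s hs => ?_
    have hs1 := hs.1
    push_cast at hs1
    have him : s.im ≠ 0 := by
      intro h
      have := hs.2
      rw [h] at this
      norm_num at this
    -- Taking `ε = s.im` treats both half planes at once, as `ε * s.im` is then a square.
    have h := landau k (ε := s.im) (s := s) (by linarith) (mul_self_pos.2 him)
    rw [Finset.sum_range_succ'] at h
    have hb : binom 1 (1 - s) = 1 - s := by simp [binom]
    simp only [zero_add, hb, Nat.cast_zero, add_zero] at h
    have h' : (∑ j ∈ Finset.range (k + 1), binom (j + 2) (1 - s) * riemannZeta (s + (j + 1 : ℕ)) +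
        ∑' n : ℕ, powRem (k + 3) (1 - s) (n + 1) 1) + 1 = -((1 - s) * riemannZeta s) := by
      linear_combination h
    rw [h', norm_neg, norm_mul]
    refine le_mul_of_one_le_left (norm_nonneg _) ?_
    exact one_le_norm_of_one_le_abs_im (by simpa using hs.2)

/-! ### Decay of gamma on vertical strips -/

lemma norm_Gamma_le {s : ℂ} (hs : 0 < s.re) : ‖Complex.Gamma s‖ ≤ Real.Gamma s.re := by
  rw [Complex.Gamma_eq_integral hs, Complex.GammaIntegral, Real.Gamma_eq_integral hs]
  refine (MeasureTheory.norm_integral_le_integral_norm _).trans (le_of_eq ?_)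
  refine MeasureTheory.setIntegral_congr_fun measurableSet_Ioi fun x (hx : 0 < x) => ?_
  simp [Complex.norm_cpow_eq_rpow_re_of_pos hx, Complex.norm_exp]

/-- Each use of the functional equation contributes a factor `s + j`, of modulus at least `|s.im|`.
-/
lemma norm_Gamma_mul_pow_le (k : ℕ) {s : ℂ} (hs : s.im ≠ 0) :
    ‖Complex.Gamma s‖ * |s.im| ^ k ≤ ‖Complex.Gamma (s + k)‖ := by
  induction k with
  | zero => simp
  | succ k ih =>
    have h0 : s + k ≠ 0 := by
      intro h
      have := congrArg Complex.im h
      simp at this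
      exact hs this
    have h1 : Complex.Gamma (s + (k + 1 : ℕ)) = (s + k) * Complex.Gamma (s + k) := by
      rw [← Complex.Gamma_add_one _ h0]
      push_cast
      ring_nf
    rw [h1, norm_mul, pow_succ, ← mul_assoc, mul_comm]
    refine mul_le_mul ?_ ih (by positivity) (norm_nonneg _)
    simpa using Complex.abs_im_le_norm (s + k)

/-- In vertical strips, the gamma function decays faster than any polynomially bounded function. -/
lemma PolyBddOn.norm_Gamma_mul_le {f : ℂ → ℂ} {a b : ℝ}
    (hf : PolyBddOn f {s | a ≤ s.re ∧ s.re ≤ b ∧ 1 ≤ |s.im|}) :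
    ∃ C : ℝ, ∀ s : ℂ, a ≤ s.re → s.re ≤ b → 1 ≤ |s.im| →
      ‖Complex.Gamma s * f s‖ ≤ C / s.im ^ 2 := by
  obtain ⟨A, C, hC, hf⟩ := hf
  obtain ⟨n, hn⟩ := exists_nat_ge (1 - a)
  -- Of the `k` powers of `|s.im|` gained, `A` absorb the growth of `f` and 2 give the decay; the
  -- shift by `n` brings the strip into the right half plane, where `Real.Gamma` bounds gamma.
  set k := A + 2 + n
  have hcont : ContinuousOn Real.Gamma (Set.Icc (a + k) (b + k)) := fun x hx => by
    have : 0 < x := by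
      have h1 := hx.1
      simp only [k] at h1
      push_cast at h1
      linarith [(Nat.cast_nonneg A : (0 : ℝ) ≤ A)]
    refine (Real.differentiableAt_Gamma fun m => ?_).continuousAt.continuousWithinAt
    linarith [(Nat.cast_nonneg m : (0 : ℝ) ≤ m)]
  obtain ⟨G, hG⟩ := isCompact_Icc.exists_bound_of_continuousOn hcont
  set D := |a| + |b| + 1
  refine ⟨G * C * D ^ A, fun s h1 h2 h3 => ?_⟩
  have him : s.im ≠ 0 := by
    intro h
    rw [h] at h3
    norm_num at h3
  have hpos : 0 < |s.im| := by linarith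
  have hre : 0 < (s + k).re := by
    simp [k]
    linarith [(Nat.cast_nonneg A : (0 : ℝ) ≤ A)]
  have hΓ : ‖Complex.Gamma s‖ * |s.im| ^ k ≤ G := by
    refine (norm_Gamma_mul_pow_le k him).trans ((norm_Gamma_le hre).trans ?_)
    refine (le_abs_self _).trans (hG _ ⟨?_, ?_⟩) <;> simp <;> linarith
  have hnorm : ‖s‖ ≤ D * |s.im| := by
    have := Complex.norm_le_abs_re_add_abs_im s
    have h4 : |s.re| ≤ |a| + |b| := by
      rw [abs_le]
      constructor
      · linarith [neg_abs_le a, abs_nonneg b]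
      · linarith [le_abs_self b, abs_nonneg a]
    nlinarith [abs_nonneg a, abs_nonneg b]
  rw [le_div_iff₀ (by positivity), norm_mul, ← sq_abs]
  calc ‖Complex.Gamma s‖ * ‖f s‖ * |s.im| ^ 2
      ≤ ‖Complex.Gamma s‖ * (C * (D * |s.im|) ^ A) * |s.im| ^ 2 := by
        gcongr
        exact (hf s ⟨h1, h2, h3⟩).trans (by gcongr)
    _ = ‖Complex.Gamma s‖ * |s.im| ^ (A + 2) * (C * D ^ A) := by rw [mul_pow]; ring
    _ ≤ ‖Complex.Gamma s‖ * |s.im| ^ k * (C * D ^ A) := by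
        gcongr
        omega
    _ ≤ G * (C * D ^ A) := by gcongr
    _ = G * C * D ^ A := by ring

/-! ### Vertical integrals and contour shifts -/

open MeasureTheory in
lemma integrable_of_le_div_sq {f : ℝ → ℂ} (hf : Continuous f) {C : ℝ}
    (hC : ∀ y, 1 ≤ |y| → ‖f y‖ ≤ C / y ^ 2) : Integrable f := by
  obtain ⟨M, hM⟩ := (isCompact_Icc (a := (-1 : ℝ)) (b := 1)).exists_bound_of_continuousOn
    hf.continuousOn
  refine ((integrable_inv_one_add_sq).const_mul (2 * max M C)).mono' hf.aestronglyMeasurable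
    (Eventually.of_forall fun y => ?_)
  rw [← div_eq_mul_inv, le_div_iff₀ (by positivity)]
  rcases le_total |y| 1 with h | h
  · have h1 := hM y (abs_le.1 h)
    have h2 : y ^ 2 ≤ 1 := by rwa [sq_le_one_iff_abs_le_one]
    have h3 := norm_nonneg (f y)
    have h4 := le_max_left M C
    nlinarith
  · have h2 : 1 ≤ y ^ 2 := by rwa [one_le_sq_iff_one_le_abs]
    have h1 := hC y h
    rw [le_div_iff₀ (by positivity)] at h1
    have h3 := norm_nonneg (f y)
    have h4 := le_max_right M C
    nlinarith

lemma continuous_vertical (σ : ℝ) : Continuous fun y : ℝ => (σ : ℂ) + y * Complex.I := by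
  fun_prop

open MeasureTheory in
/-- Shifting a vertical line of integration. -/
lemma integral_vertical_eq {G : ℂ → ℂ} {a b C : ℝ} (hab : a ≤ b)
    (hd : DifferentiableOn ℂ G {s | a ≤ s.re ∧ s.re ≤ b})
    (hC : ∀ s : ℂ, a ≤ s.re → s.re ≤ b → 1 ≤ |s.im| → ‖G s‖ ≤ C / s.im ^ 2) :
    ∫ y : ℝ, G (a + y * Complex.I) = ∫ y : ℝ, G (b + y * Complex.I) := by
  have hint : ∀ c, a ≤ c → c ≤ b → Integrable fun y : ℝ => G (c + y * Complex.I) := by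
    intro c h1 h2
    refine integrable_of_le_div_sq (C := C) ?_ fun y hy => ?_
    · exact hd.continuousOn.comp_continuous (continuous_vertical c) fun y => by simp [h1, h2]
    · simpa using hC (c + y * Complex.I) (by simpa) (by simpa) (by simpa)
  have hlim : ∀ c, a ≤ c → c ≤ b → Tendsto (fun T : ℝ => ∫ y in (-T)..T, G (c + y * Complex.I))
      atTop (𝓝 (∫ y : ℝ, G (c + y * Complex.I))) := fun c h1 h2 =>
    intervalIntegral_tendsto_integral (hint c h1 h2) tendsto_neg_atTop_atBot tendsto_id
  -- Here `ε = ±1` selects the top or bottom side of the rectangle; the integral over it is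
  -- `O(T⁻²)`.
  have hhor : ∀ ε : ℝ, |ε| = 1 →
      Tendsto (fun T : ℝ => ∫ x in a..b, G (x + (ε * T : ℝ) * Complex.I)) atTop (𝓝 0) := by
    intro ε hε
    have hb : ∀ᶠ T : ℝ in atTop, ‖∫ x in a..b, G (x + (ε * T : ℝ) * Complex.I)‖ ≤
        C * |b - a| * (T ^ 2)⁻¹ := by
      filter_upwards [eventually_ge_atTop 1] with T hT
      have h := intervalIntegral.norm_integral_le_of_norm_le_const (a := a) (b := b)
        (f := fun x => G (x + (ε * T : ℝ) * Complex.I)) (C := C / T ^ 2) ?_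
      · refine h.trans (le_of_eq ?_)
        rw [div_eq_mul_inv]; ring
      · intro x hx
        rw [Set.uIoc_of_le hab] at hx
        have h := hC (x + (ε * T : ℝ) * Complex.I) (by simpa using hx.1.le) (by simpa using hx.2)
          (by simpa [abs_mul, hε] using hT.trans (le_abs_self T))
        have hε2 : ε ^ 2 = 1 := by rw [← sq_abs, hε, one_pow]
        simpa [mul_pow, hε2] using h
    refine squeeze_zero_norm' hb ?_
    have : Tendsto (fun T : ℝ => (T ^ 2)⁻¹) atTop (𝓝 0) :=
      tendsto_inv_atTop_zero.comp (tendsto_pow_atTop two_ne_zero)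
    simpa using this.const_mul (C * |b - a|)
  have hrect : ∀ T : ℝ, ((∫ x in a..b, G (x + (-1 * T : ℝ) * Complex.I)) -
      ∫ x in a..b, G (x + (1 * T : ℝ) * Complex.I)) +
      Complex.I * (∫ y in (-T)..T, G (b + y * Complex.I)) -
      Complex.I * (∫ y in (-T)..T, G (a + y * Complex.I)) = 0 := by
    intro T
    have h := Complex.integral_boundary_rect_eq_zero_of_differentiableOn G
      (a + (-T : ℝ) * Complex.I) (b + T * Complex.I) (hd.mono ?_)
    · simpa using h
    · rintro s ⟨hs, -⟩
      simp only [Complex.add_re, Complex.ofReal_re, Complex.mul_re, Complex.ofReal_im, Complex.I_re,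
        mul_zero, Complex.I_im, mul_one, sub_self, add_zero, Set.mem_preimage,
        Set.uIcc_of_le hab] at hs
      exact hs
  have h := (((hhor (-1) (by simp)).sub (hhor 1 (by simp))).add
    ((hlim b hab le_rfl).const_mul Complex.I)).sub ((hlim a le_rfl hab).const_mul Complex.I)
  have h2 := tendsto_nhds_unique (h.congr hrect) tendsto_const_nhds
  rw [sub_self, zero_add, ← mul_sub, mul_eq_zero] at h2
  rcases h2 with h2 | h2
  · exact absurd h2 Complex.I_ne_zero
  · exact (sub_eq_zero.1 h2).symm

lemma norm_cpow_neg_vertical {x : ℝ} (hx : 0 < x) (s : ℂ) : ‖(x : ℂ) ^ (-s)‖ = x ^ (-s.re) := by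
  rw [Complex.norm_cpow_eq_rpow_re_of_pos hx, Complex.neg_re]

lemma continuous_cpow_vertical {x : ℝ} (hx : 0 < x) (σ : ℝ) :
    Continuous fun y : ℝ => (x : ℂ) ^ (-((σ : ℂ) + y * Complex.I)) := by
  refine Continuous.const_cpow (continuous_vertical σ).neg (Or.inl ?_)
  exact_mod_cast hx.ne'

/-- Contour shift for the inverse Mellin transform. -/
lemma mellinInv_eq_mellinInv {H : ℂ → ℂ} {a b C x : ℝ} (hx : 0 < x) (hab : a ≤ b)
    (hd : DifferentiableOn ℂ H {s | a ≤ s.re ∧ s.re ≤ b})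
    (hC : ∀ s : ℂ, a ≤ s.re → s.re ≤ b → 1 ≤ |s.im| → ‖H s‖ ≤ C / s.im ^ 2) :
    mellinInv a H x = mellinInv b H x := by
  have hx0 : (x : ℂ) ≠ 0 := by exact_mod_cast hx.ne'
  obtain ⟨M, hM⟩ := (isCompact_Icc (a := a) (b := b)).exists_bound_of_continuousOn
    (f := fun u : ℝ => x ^ (-u))
    (Continuous.continuousOn (Continuous.rpow continuous_const continuous_neg fun _ => Or.inl hx.ne'))
  rw [mellinInv, mellinInv, integral_vertical_eq (G := fun s => (x : ℂ) ^ (-s) • H s) hab (C := M * C)]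
  · have h1 : Differentiable ℂ fun s : ℂ => (x : ℂ) ^ (-s) := fun s =>
      differentiableAt_id.neg.const_cpow (Or.inl hx0)
    exact h1.differentiableOn.smul hd
  · intro s h1 h2 h3
    rw [norm_smul, norm_cpow_neg_vertical hx, mul_div_assoc]
    have h4 := hM s.re ⟨h1, h2⟩
    refine mul_le_mul ((le_abs_self _).trans h4) (hC s h1 h2 h3) (norm_nonneg _)
      ((norm_nonneg _).trans h4)

-- This turns the position of the line into a power of `x`. No integrability is required, since a
-- non-integrable integrand has integral zero.
open MeasureTheory in
lemma norm_mellinInv_le (H : ℂ → ℂ) (σ : ℝ) {x : ℝ} (hx : 0 < x) :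
    ‖mellinInv σ H x‖ ≤ (1 / (2 * Real.pi) * ∫ y : ℝ, ‖H (σ + y * Complex.I)‖) * x ^ (-σ) := by
  rw [mellinInv, norm_smul, Real.norm_of_nonneg (by positivity), mul_assoc]
  refine mul_le_mul_of_nonneg_left ?_ (by positivity)
  refine (norm_integral_le_integral_norm _).trans (le_of_eq ?_)
  rw [← integral_mul_const]
  congr 1
  ext y
  rw [norm_smul, norm_cpow_neg_vertical hx]
  simp [mul_comm]

open MeasureTheory in
lemma integrable_cpow_mul {f : ℂ → ℂ} {σ : ℝ} (hf : Complex.VerticalIntegrable f σ) {x : ℝ}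
    (hx : 0 < x) :
    Integrable fun y : ℝ => (x : ℂ) ^ (-((σ : ℂ) + y * Complex.I)) • f (σ + y * Complex.I) := by
  simp_rw [smul_eq_mul]
  refine Integrable.bdd_mul (c := x ^ (-σ)) hf
    (continuous_cpow_vertical hx σ).aestronglyMeasurable (Eventually.of_forall fun y => ?_)
  rw [norm_cpow_neg_vertical hx]
  simp

lemma mellinInv_sub {f g : ℂ → ℂ} {σ : ℝ} (hf : Complex.VerticalIntegrable f σ)
    (hg : Complex.VerticalIntegrable g σ) {x : ℝ} (hx : 0 < x) :
    mellinInv σ (fun s => f s - g s) x = mellinInv σ f x - mellinInv σ g x := by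
  simp_rw [mellinInv, smul_sub]
  rw [MeasureTheory.integral_sub (integrable_cpow_mul hf hx) (integrable_cpow_mul hg hx), smul_sub]

lemma mellinInv_sum {ι : Type*} (u : Finset ι) {f : ι → ℂ → ℂ} {σ : ℝ}
    (hf : ∀ i ∈ u, Complex.VerticalIntegrable (f i) σ) {x : ℝ} (hx : 0 < x) :
    mellinInv σ (fun s => ∑ i ∈ u, f i s) x = ∑ i ∈ u, mellinInv σ (f i) x := by
  simp_rw [mellinInv, Finset.smul_sum]
  rw [MeasureTheory.integral_finsetSum _ fun i hi => integrable_cpow_mul (hf i hi) hx,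
    Finset.smul_sum]

lemma mellinInv_const_mul (c : ℂ) (f : ℂ → ℂ) (σ x : ℝ) :
    mellinInv σ (fun s => c * f s) x = c * mellinInv σ f x := by
  simp_rw [mellinInv, smul_eq_mul, mul_left_comm _ c]
  rw [MeasureTheory.integral_const_mul, mul_smul_comm]

/-! ### Explicit inverse Mellin transforms -/

lemma vertical_ne {σ : ℝ} {u : ℝ} (h : 0 < σ + u) (y : ℝ) :
    (σ : ℂ) + y * Complex.I + u ≠ 0 := by
  intro h0
  have := congrArg Complex.re h0
  simp at this
  linarith

lemma abs_im_le_norm_add (s : ℂ) (u : ℝ) : |s.im| ≤ ‖s + u‖ := by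
  simpa using Complex.abs_im_le_norm (s + u)

lemma norm_one_div_sub_le (s : ℂ) (u v : ℝ) (h : s.im ≠ 0) :
    ‖1 / (s + u) - 1 / (s + v)‖ ≤ |v - u| / s.im ^ 2 := by
  have h1 := abs_im_le_norm_add s u
  have h2 := abs_im_le_norm_add s v
  have h0 : 0 < |s.im| := abs_pos.2 h
  have h3 : s + u ≠ 0 := norm_pos_iff.1 (h0.trans_le h1)
  have h4 : s + v ≠ 0 := norm_pos_iff.1 (h0.trans_le h2)
  rw [div_sub_div _ _ h3 h4, norm_div, norm_mul, ← sq_abs, sq]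
  have : 1 * (s + v) - (s + u) * 1 = ((v - u : ℝ) : ℂ) := by push_cast; ring
  rw [this, Complex.norm_real, Real.norm_eq_abs]
  gcongr

lemma norm_one_div_sq_le (s : ℂ) (u : ℝ) (h : s.im ≠ 0) :
    ‖1 / (s + u) ^ 2‖ ≤ 1 / s.im ^ 2 := by
  have h1 := abs_im_le_norm_add s u
  have h0 : 0 < |s.im| := abs_pos.2 h
  rw [norm_div, norm_one, norm_pow, ← sq_abs s.im]
  gcongr

lemma im_ne_zero_of_one_le_abs {y : ℝ} (h : 1 ≤ |y|) : y ≠ 0 := by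
  rintro rfl
  norm_num at h

lemma verticalIntegrable_one_div_sub {σ u v : ℝ} (hu : 0 < σ + u) (hv : 0 < σ + v) :
    Complex.VerticalIntegrable (fun s => 1 / (s + u) - 1 / (s + v)) σ := by
  refine integrable_of_le_div_sq (C := |v - u|) ?_ fun y hy => ?_
  · refine Continuous.sub ?_ ?_ <;>
    refine continuous_const.div (by fun_prop) (vertical_ne (by assumption))
  · simpa using norm_one_div_sub_le (σ + y * Complex.I) u v
      (by simpa using im_ne_zero_of_one_le_abs hy)

lemma verticalIntegrable_one_div_sq {σ u : ℝ} (hu : 0 < σ + u) :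
    Complex.VerticalIntegrable (fun s => 1 / (s + u) ^ 2) σ := by
  refine integrable_of_le_div_sq (C := 1) ?_ fun y hy => ?_
  · exact continuous_const.div (by fun_prop) fun y => pow_ne_zero 2 (vertical_ne hu y)
  · simpa using norm_one_div_sq_le (σ + y * Complex.I) u
      (by simpa using im_ne_zero_of_one_le_abs hy)

lemma eventuallyEq_indicator {E : Type*} [Zero E] (f : ℝ → E) {x : ℝ} (h0 : 0 < x) (h1 : x < 1) :
    (Set.Ioc (0 : ℝ) 1).indicator f =ᶠ[𝓝 x] f := by
  filter_upwards [Ioo_mem_nhds h0 h1] with y hy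
  exact Set.indicator_of_mem (s := Set.Ioc (0 : ℝ) 1) ⟨hy.1, hy.2.le⟩ f

lemma mellinInv_congr {f g : ℂ → ℂ} {σ : ℝ} (h : ∀ y : ℝ, f (σ + y * Complex.I) = g (σ + y * Complex.I))
    (x : ℝ) : mellinInv σ f x = mellinInv σ g x := by
  simp_rw [mellinInv, h]

/-- Mellin inversion for a function whose Mellin transform is known on the line of integration. -/
lemma mellinInv_of_hasMellin {f : ℝ → ℂ} {g : ℂ → ℂ} {σ x : ℝ} (hx : 0 < x)
    (h : ∀ y : ℝ, HasMellin f (σ + y * Complex.I) (g (σ + y * Complex.I)))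
    (hg : Complex.VerticalIntegrable g σ) (hf : ContinuousAt f x) : mellinInv σ g x = f x := by
  have h1 : ∀ y : ℝ, mellin f (σ + y * Complex.I) = g (σ + y * Complex.I) := fun y => (h y).2
  rw [← mellinInv_mellin_eq σ f hx (by simpa using (h 0).1) _ hf]
  · exact (mellinInv_congr h1 x).symm
  · simpa only [Complex.VerticalIntegrable, h1] using hg

/-- A single simple fraction is not integrable on a vertical line, but a difference of two decays
quadratically. It is the Mellin transform of `t^u - t^v` cut off to `(0, 1]`, hence the restriction
`x < 1`. -/
lemma mellinInv_one_div_sub {σ u v x : ℝ} (hu : 0 < σ + u) (hv : 0 < σ + v) (h0 : 0 < x)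
    (h1 : x < 1) :
    mellinInv σ (fun s => 1 / (s + u) - 1 / (s + v)) x = (x : ℂ) ^ (u : ℂ) - (x : ℂ) ^ (v : ℂ) := by
  have hev : (fun t => (Set.Ioc (0 : ℝ) 1).indicator (fun t : ℝ => (t : ℂ) ^ (u : ℂ)) t -
      (Set.Ioc (0 : ℝ) 1).indicator (fun t : ℝ => (t : ℂ) ^ (v : ℂ)) t)
      =ᶠ[𝓝 x] fun t => (t : ℂ) ^ (u : ℂ) - (t : ℂ) ^ (v : ℂ) :=
    (eventuallyEq_indicator _ h0 h1).sub (eventuallyEq_indicator _ h0 h1)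
  rw [← hev.eq_of_nhds]
  refine mellinInv_of_hasMellin (f := fun t =>
      (Set.Ioc (0 : ℝ) 1).indicator (fun t : ℝ => (t : ℂ) ^ (u : ℂ)) t -
      (Set.Ioc (0 : ℝ) 1).indicator (fun t : ℝ => (t : ℂ) ^ (v : ℂ)) t)
    h0 (fun y => ?_) (verticalIntegrable_one_div_sub hu hv) ?_
  · have e1 := hasMellin_cpow_Ioc (u : ℂ) (s := σ + y * Complex.I) (by simpa using hu)
    have e2 := hasMellin_cpow_Ioc (v : ℂ) (s := σ + y * Complex.I) (by simpa using hv)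
    have := hasMellin_sub e1.1 e2.1
    rwa [e1.2, e2.2] at this
  · refine ContinuousAt.congr ?_ hev.symm
    have := h0.ne'
    exact (Complex.continuousAt_ofReal_cpow_const _ _ (Or.inr this)).sub
      (Complex.continuousAt_ofReal_cpow_const _ _ (Or.inr this))

/-- Differentiating a Mellin transform in `s` multiplies the original function by `log t`, so the
double pole comes from differentiating the transform `1 / (s + u)` of the truncated power. -/
lemma mellinInv_one_div_sq {σ u x : ℝ} (hu : 0 < σ + u) (h0 : 0 < x) (h1 : x < 1) :
    mellinInv σ (fun s => 1 / (s + u) ^ 2) x = (x : ℂ) ^ (u : ℂ) * ((-Real.log x : ℝ) : ℂ) := by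
  set g : ℝ → ℂ := (Set.Ioc (0 : ℝ) 1).indicator (fun t : ℝ => (t : ℂ) ^ (u : ℂ)) with hg
  have hgx := eventuallyEq_indicator (fun t : ℝ => (t : ℂ) ^ (u : ℂ)) h0 h1
  have hnorm : ∀ t : ℝ, 0 < t → ‖g t‖ ≤ t ^ (-(-u)) := by
    intro t ht
    rw [hg]
    refine (norm_indicator_le_norm_self _ _).trans ?_
    rw [Complex.norm_cpow_eq_rpow_re_of_pos ht]
    simp
  have hloc : MeasureTheory.LocallyIntegrableOn g (Set.Ioi 0) := by
    have h2 : MeasureTheory.LocallyIntegrableOn (fun t : ℝ => (t : ℂ) ^ (u : ℂ)) (Set.Ioi 0) :=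
      ContinuousOn.locallyIntegrableOn (fun t (ht : 0 < t) =>
        (Complex.continuousAt_ofReal_cpow_const _ _ (Or.inr ht.ne')).continuousWithinAt)
        measurableSet_Ioi
    rw [MeasureTheory.locallyIntegrableOn_iff isOpen_Ioi.isLocallyClosed] at h2 ⊢
    exact fun K hK hKc => (h2 K hK hKc).indicator measurableSet_Ioc
  have hder : ∀ y : ℝ, HasMellin (fun t : ℝ => -(Real.log t • g t)) (σ + y * Complex.I)
      (1 / (σ + y * Complex.I + u) ^ 2) := by
    intro y
    set s : ℂ := σ + y * Complex.I
    have hs : s.re = σ := by simp [s]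
    -- The exponent `s.re + 1` at infinity is one convenient choice: `g` vanishes beyond 1.
    have h2 := mellin_hasDerivAt_of_isBigO_rpow (f := g) (s := s) (a := s.re + 1) (b := -u) hloc ?_
      (by linarith) ?_ (by linarith)
    · have h3 : mellin g =ᶠ[𝓝 s] fun z => 1 / (z + u) := by
        have : {z : ℂ | -u < z.re} ∈ 𝓝 s :=
          (isOpen_lt continuous_const Complex.continuous_re).mem_nhds (by
            simp only [Set.mem_ofPred_eq]; linarith)
        filter_upwards [this] with z hz
        exact (hasMellin_cpow_Ioc (u : ℂ) (s := z) (by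
          have hz' : -u < z.re := hz
          simp; linarith)).2
      have hne : s + u ≠ 0 := vertical_ne hu y
      have h4 : HasDerivAt (fun z : ℂ => 1 / (z + u)) (-(1 / (s + u) ^ 2)) s := by
        have := ((hasDerivAt_id s).add_const (u : ℂ)).inv hne
        simp only [id] at this
        rw [← neg_div]
        refine this.congr_of_eventuallyEq (Eventually.of_forall fun z => ?_)
        simp
      have h5 := h2.2.unique (h4.congr_of_eventuallyEq h3)
      refine ⟨?_, ?_⟩
      · have := MeasureTheory.IntegrableOn.neg h2.1
        simp_rw [MellinConvergent, smul_neg]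
        exact this
      have h6 : mellin (fun t : ℝ => -(Real.log t • g t)) s = -mellin (fun t => Real.log t • g t) s := by
        simp_rw [mellin, smul_neg]
        rw [MeasureTheory.integral_neg]
      rw [h6, h5, neg_neg]
    · refine IsBigO.of_bound 1 ?_
      filter_upwards [eventually_gt_atTop 1] with t ht
      rw [hg, Set.indicator_of_notMem (by simp [ht])]
      simp
    · refine IsBigO.of_bound 1 ?_
      filter_upwards [self_mem_nhdsWithin] with t (ht : 0 < t)
      rw [one_mul]
      exact (hnorm t ht).trans (le_abs_self _)
  rw [mellinInv_of_hasMellin h0 hder (verticalIntegrable_one_div_sq hu)]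
  · have : g x = (x : ℂ) ^ (u : ℂ) := hgx.eq_of_nhds
    rw [this, Complex.real_smul]
    push_cast
    ring
  · refine ((Real.continuousAt_log h0.ne').smul ?_).neg
    exact (Complex.continuousAt_ofReal_cpow_const _ _ (Or.inr h0.ne')).congr hgx.symm

lemma continuous_Gamma_vertical {σ : ℝ} (hσ : 0 < σ) :
    Continuous fun y : ℝ => Complex.Gamma (σ + y * Complex.I) := by
  rw [continuous_iff_continuousAt]
  intro y
  refine ContinuousAt.comp (g := Complex.Gamma) ?_ (continuous_vertical σ).continuousAt
  refine (Complex.differentiableAt_Gamma _ fun m h => ?_).continuousAt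
  have := congrArg Complex.re h
  simp at this
  linarith [(Nat.cast_nonneg m : (0 : ℝ) ≤ m)]

lemma verticalIntegrable_Gamma {σ : ℝ} (hσ : 0 < σ) :
    Complex.VerticalIntegrable Complex.Gamma σ := by
  obtain ⟨C, hC⟩ := PolyBddOn.norm_Gamma_mul_le (a := σ) (b := σ) (PolyBddOn.const 1)
  refine integrable_of_le_div_sq (C := C) (continuous_Gamma_vertical hσ) fun y hy => ?_
  simpa using hC (σ + y * Complex.I) (by simp) (by simp) (by simpa using hy)

lemma mellinInv_Gamma {σ x : ℝ} (hσ : 0 < σ) (hx : 0 < x) :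
    mellinInv σ Complex.Gamma x = Complex.exp (-x) := by
  have h := mellinInv_of_hasMellin (f := fun x : ℝ => ((Real.exp (-x) : ℝ) : ℂ)) hx (fun y => ?_)
    (verticalIntegrable_Gamma hσ) (by fun_prop)
  · rw [h]; simp
  · have hs : 0 < ((σ : ℂ) + y * Complex.I).re := by simpa
    refine ⟨?_, ?_⟩
    · have := Complex.GammaIntegral_convergent hs
      refine this.congr_fun (fun t _ => ?_) measurableSet_Ioi
      simp [mul_comm]
    · rw [Complex.Gamma_eq_integral hs, Complex.GammaIntegral_eq_mellin]

/-! ### Dirichlet series under the inverse Mellin transform -/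

open MeasureTheory in
/-- The inverse Mellin transform of the gamma function times a Dirichlet series. -/
lemma hasSum_mellinInv {ι : Type*} [Countable ι] {a : ι → ℂ} {p : ι → ℝ} {L : ℂ → ℂ} {σ t : ℝ}
    (hσ : 0 < σ) (ht : 0 < t) (hp : ∀ i, 0 < p i)
    (hL : ∀ s : ℂ, s.re = σ → HasSum (fun i => a i * (p i : ℂ) ^ (-s)) (L s))
    (hsum : Summable fun i => ‖a i‖ * p i ^ (-σ)) :
    HasSum (fun i => a i * Complex.exp (-(p i * t : ℝ)))
      (mellinInv σ (fun s => Complex.Gamma s * L s) t) := by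
  set V : ℝ → ℂ := fun y => σ + y * Complex.I with hV
  set F : ι → ℝ → ℂ := fun i y =>
    a i * (((p i * t : ℝ) : ℂ) ^ (-V y) • Complex.Gamma (V y)) with hF
  have hpt : ∀ i, 0 < p i * t := fun i => mul_pos (hp i) ht
  have hint : ∀ i, Integrable (F i) := fun i =>
    (integrable_cpow_mul (verticalIntegrable_Gamma hσ) (hpt i)).const_mul _
  have hnorm : ∀ i, ∫ y, ‖F i y‖ =
      ‖a i‖ * p i ^ (-σ) * (t ^ (-σ) * ∫ y, ‖Complex.Gamma (V y)‖) := by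
    intro i
    rw [← integral_const_mul, ← integral_const_mul]
    congr 1
    ext y
    rw [hF]
    simp only
    rw [norm_mul, norm_smul, norm_cpow_neg_vertical (hpt i), Real.mul_rpow (hp i).le ht.le]
    simp [hV]
    ring
  -- Sum and integral may be exchanged: the integrals of the norms are a fixed constant times the
  -- terms of `hsum`.
  have h := hasSum_integral_of_summable_integral_norm hint (by
    simp_rw [hnorm]
    exact hsum.mul_right _)
  have h1 : ∀ y : ℝ, ∑' i, F i y = (t : ℂ) ^ (-V y) • (Complex.Gamma (V y) * L (V y)) := by
    intro y
    have := ((hL (V y) (by simp [hV])).mul_left ((t : ℂ) ^ (-V y) * Complex.Gamma (V y))).tsum_eq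
    rw [smul_eq_mul, ← mul_assoc, ← this]
    congr 1
    ext i
    rw [hF]
    simp only [smul_eq_mul]
    rw [Complex.ofReal_mul, Complex.mul_cpow_ofReal_nonneg (hp i).le ht.le]
    ring
  simp_rw [h1] at h
  have h2 := h.const_smul (1 / (2 * Real.pi))
  rw [mellinInv]
  refine h2.congr_fun fun i => ?_
  rw [hF]
  simp only
  rw [integral_const_mul, ← mul_smul_comm, ← mellinInv_Gamma hσ (hpt i)]
  rfl

/-- Induction on the number of variables, splitting off the first coordinate and multiplying two
absolutely convergent series. -/
lemma summable_prod_and_tsum {β : Type*} : ∀ {n : ℕ} (f : Fin n → β → ℂ),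
    (∀ j, Summable fun b => ‖f j b‖) →
    (Summable fun d : Fin n → β => ‖∏ j, f j (d j)‖) ∧
      ∑' d : Fin n → β, ∏ j, f j (d j) = ∏ j, ∑' b, f j b
  | 0, f, _ => by
    refine ⟨(hasSum_fintype _).summable, ?_⟩
    simp
  | n + 1, f, hf => by
    obtain ⟨h1, h2⟩ := summable_prod_and_tsum (fun j : Fin n => f j.succ) fun j => hf j.succ
    have e : ∀ z : β × (Fin n → β), ∏ j, f j ((Fin.consEquiv fun _ => β) z j) =
        f 0 z.1 * ∏ j : Fin n, f j.succ (z.2 j) := by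
      intro z
      rw [Fin.prod_univ_succ]
      simp
    constructor
    · rw [← (Fin.consEquiv fun _ => β).summable_iff]
      refine ((hf 0).mul_norm h1).congr fun z => ?_
      simp only [Function.comp]
      rw [e]
    · rw [← (Fin.consEquiv fun _ => β).tsum_eq, Fin.prod_univ_succ, ← h2,
        tsum_mul_tsum_of_summable_norm (hf 0) h1]
      exact tsum_congr e

lemma hasSum_prod {β : Type*} {n : ℕ} {f : Fin n → β → ℂ} {A : Fin n → ℂ}
    (h : ∀ j, HasSum (f j) (A j)) :
    HasSum (fun d : Fin n → β => ∏ j, f j (d j)) (∏ j, A j) := by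
  obtain ⟨h1, h2⟩ := summable_prod_and_tsum f fun j => (h j).summable.norm
  simp_rw [← fun j => (h j).tsum_eq, ← h2]
  exact h1.of_norm.hasSum

/-! ### Local expansions of gamma and zeta -/

lemma psCoeff_congr (k : ℕ) {f g : ℂ → ℂ} (h : f =ᶠ[𝓝[≠] 0] g) (hg : ContinuousAt g 0) :
    psCoeff k f = iteratedDeriv k g 0 / (k ! : ℂ) := by
  have hlim : limUnder (𝓝[≠] (0 : ℂ)) f = g 0 :=
    ((hg.tendsto.mono_left nhdsWithin_le_nhds).congr' h.symm).limUnder_eq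
  have h2 : Function.update f 0 (limUnder (𝓝[≠] (0 : ℂ)) f) =ᶠ[𝓝 0] g := by
    rw [hlim]
    have := eventually_nhdsWithin_iff.1 h
    filter_upwards [this] with z hz
    by_cases h0 : z = 0
    · simp [h0]
    · rw [Function.update_of_ne h0]
      exact hz h0
  rw [psCoeff, h2.iteratedDeriv_eq]

lemma psCoeff_zero {f g : ℂ → ℂ} (h : f =ᶠ[𝓝[≠] 0] g) (hg : ContinuousAt g 0) :
    psCoeff 0 f = g 0 := by
  simp [psCoeff_congr 0 h hg]

lemma psCoeff_one {f g : ℂ → ℂ} {g' : ℂ} (h : f =ᶠ[𝓝[≠] 0] g) (hg : HasDerivAt g g' 0) :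
    psCoeff 1 f = g' := by
  simp [psCoeff_congr 1 h hg.continuousAt, hg.deriv]

lemma hasDerivAt_id_mul {h : ℂ → ℂ} (hh : DifferentiableAt ℂ h 0) :
    HasDerivAt (fun z => z * h z) (h 0) 0 := by
  simpa using (hasDerivAt_id' (0 : ℂ)).fun_mul hh.hasDerivAt

lemma psCoeff_id_mul_zero {h : ℂ → ℂ} (hh : AnalyticAt ℂ h 0) :
    psCoeff 0 (fun z => z * h z) = 0 := by
  rw [psCoeff_zero (EventuallyEq.refl _ _) (hasDerivAt_id_mul hh.differentiableAt).continuousAt]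
  simp

lemma psCoeff_id_mul_one {h : ℂ → ℂ} (hh : AnalyticAt ℂ h 0) :
    psCoeff 1 (fun z => z * h z) = h 0 :=
  psCoeff_one (EventuallyEq.refl _ _) (hasDerivAt_id_mul hh.differentiableAt)

lemma psCoeff_id_mul_two {h : ℂ → ℂ} (hh : AnalyticAt ℂ h 0) :
    psCoeff 2 (fun z => z * h z) = deriv h 0 := by
  rw [psCoeff_congr 2 (EventuallyEq.refl _ _) (hasDerivAt_id_mul hh.differentiableAt).continuousAt,
    iteratedDeriv_succ, iteratedDeriv_one]
  have h1 : deriv (fun z => z * h z) =ᶠ[𝓝 0] fun z => h z + z * deriv h z := by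
    filter_upwards [hh.eventually_analyticAt] with z hz
    simpa using ((hasDerivAt_id' z).fun_mul hz.differentiableAt.hasDerivAt).deriv
  have h2 : HasDerivAt (fun z => h z + z * deriv h z) (deriv h 0 + deriv h 0) 0 :=
    hh.differentiableAt.hasDerivAt.add (hasDerivAt_id_mul hh.deriv.differentiableAt)
  rw [h1.deriv_eq, h2.deriv]
  simp

lemma analyticAt_Gamma {s : ℂ} (h : ∀ m : ℕ, s ≠ -m) : AnalyticAt ℂ Complex.Gamma s := by
  have h1 : AnalyticAt ℂ (fun s => (Complex.Gamma s)⁻¹) s :=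
    Complex.differentiable_one_div_Gamma.analyticAt s
  have h2 := h1.fun_inv (inv_ne_zero (Complex.Gamma_ne_zero h))
  simpa using h2

/-- The expansion of the gamma function at its poles, to second order. -/
lemma exists_Gamma_jet (a : ℕ) : ∃ g : ℂ → ℂ, AnalyticAt ℂ g 0 ∧
    (fun z => z * Complex.Gamma (-(a : ℂ) + z)) =ᶠ[𝓝[≠] 0] g ∧ g 0 = (-1) ^ a / (a ! : ℂ) ∧
    HasDerivAt g ((-1) ^ a / (a ! : ℂ) *
      (((harmonic a : ℚ) : ℂ) - Real.eulerMascheroniConstant)) 0 := by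
  induction a with
  | zero =>
    have hΓ : AnalyticAt ℂ Complex.Gamma 1 := by
      refine analyticAt_Gamma fun m h => ?_
      have := congrArg Complex.re h
      simp at this
      linarith [(Nat.cast_nonneg m : (0 : ℝ) ≤ m)]
    refine ⟨fun z => Complex.Gamma (1 + z), ?_, ?_, ?_, ?_⟩
    · exact AnalyticAt.fun_comp (g := Complex.Gamma) (by simpa using hΓ) (by fun_prop)
    · filter_upwards [self_mem_nhdsWithin] with z hz
      have hz' : z ≠ 0 := hz
      simp only [Nat.cast_zero, neg_zero, zero_add]
      rw [add_comm, Complex.Gamma_add_one z hz']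
    · simp
    · have h : HasDerivAt Complex.Gamma (-Real.eulerMascheroniConstant : ℂ) (1 + 0) := by
        simpa using Complex.hasDerivAt_Gamma_one
      simpa using h.comp_const_add 1 0
  | succ a ih =>
    obtain ⟨g, hg, hev, h0, h1⟩ := ih
    have hne : (0 : ℂ) - (a + 1) ≠ 0 := by
      rw [zero_sub, neg_ne_zero]
      exact_mod_cast Nat.succ_ne_zero a
    have hne' : (a : ℂ) + 1 ≠ 0 := by exact_mod_cast Nat.succ_ne_zero a
    have hf : ((a ! : ℕ) : ℂ) ≠ 0 := by exact_mod_cast Nat.factorial_ne_zero a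
    refine ⟨fun z => g z / (z - (a + 1)), hg.fun_div (by fun_prop) hne, ?_, ?_, ?_⟩
    · have : ∀ᶠ z : ℂ in 𝓝[≠] 0, z - (a + 1) ≠ 0 := by
        refine Filter.Eventually.filter_mono nhdsWithin_le_nhds ?_
        exact (by fun_prop : ContinuousAt (fun z : ℂ => z - (a + 1)) 0).eventually_ne hne
      filter_upwards [hev, this] with z hz hz2
      rw [← hz, eq_div_iff hz2]
      have h3 : -(a : ℂ) + z = (-((a + 1 : ℕ) : ℂ) + z) + 1 := by push_cast; ring
      rw [h3, Complex.Gamma_add_one]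
      · push_cast; ring
      · push_cast
        rwa [neg_add_eq_sub]
    · simp only [h0, Nat.factorial_succ, zero_sub]
      push_cast
      rw [pow_succ]
      field_simp
    -- Dividing by `z - (a + 1)` adds `1 / (a + 1)` to the logarithmic derivative at 0, which is how
    -- the harmonic number accumulates from the base value `Γ'(1) = -γ`.
    · refine (h1.fun_div ((hasDerivAt_id' (0 : ℂ)).sub_const _) hne).congr_deriv ?_
      rw [h0, Nat.factorial_succ, harmonic_succ]
      push_cast
      rw [pow_succ]
      field_simp
      ring

lemma analyticAt_riemannZeta {s : ℂ} (h : s ≠ 1) : AnalyticAt ℂ riemannZeta s := by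
  refine DifferentiableOn.analyticAt (s := {1}ᶜ) (fun z hz => ?_) (isOpen_ne.mem_nhds h)
  exact (differentiableAt_riemannZeta hz).differentiableWithinAt

lemma analyticAt_riemannZeta_add {c : ℂ} (h : c ≠ 1) :
    AnalyticAt ℂ (fun z => riemannZeta (c + z)) 0 :=
  AnalyticAt.fun_comp (g := riemannZeta) (by simpa using analyticAt_riemannZeta h) (by fun_prop)

lemma deriv_riemannZeta_add (c : ℂ) :
    deriv (fun z => riemannZeta (c + z)) 0 = deriv riemannZeta c := by
  rw [deriv_comp_const_add, add_zero]

/-- The expansion of the zeta function at its pole, to second order. -/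
lemma exists_zeta_jet : ∃ g : ℂ → ℂ, AnalyticAt ℂ g 0 ∧
    (fun z => z * riemannZeta (1 + z)) =ᶠ[𝓝[≠] 0] g ∧ g 0 = 1 ∧
    HasDerivAt g (Real.eulerMascheroniConstant : ℂ) 0 := by
  set g : ℂ → ℂ := Function.update (fun z => z * riemannZeta (1 + z)) 0 1 with hg
  have hev : ∀ z, z ≠ 0 → g z = z * riemannZeta (1 + z) := fun z hz => by
    rw [hg, Function.update_of_ne hz]
  have h0 : g 0 = 1 := by simp [hg]
  have hd : HasDerivAt g (Real.eulerMascheroniConstant : ℂ) 0 := by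
    rw [hasDerivAt_iff_tendsto_slope]
    have h1 : Tendsto (fun z : ℂ => 1 + z) (𝓝[≠] 0) (𝓝[≠] 1) := by
      refine tendsto_nhdsWithin_iff.2 ⟨?_, ?_⟩
      · have : Tendsto (fun z : ℂ => 1 + z) (𝓝 0) (𝓝 (1 + 0)) :=
          (by fun_prop : Continuous fun z : ℂ => 1 + z).tendsto 0
        rw [add_zero] at this
        exact this.mono_left nhdsWithin_le_nhds
      · filter_upwards [self_mem_nhdsWithin] with z hz
        simpa using hz
    -- The slope of `g` at 0 is `ζ(1 + z) - 1/z`, whose limit is Euler's constant.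
    refine (tendsto_riemannZeta_sub_one_div.comp h1).congr' ?_
    filter_upwards [self_mem_nhdsWithin] with z hz
    have hz' : z ≠ 0 := hz
    simp only [Function.comp, slope_def_field, h0, hev z hz', sub_zero, add_sub_cancel_left]
    field_simp
  refine ⟨g, ?_, ?_, h0, hd⟩
  · refine Differentiable.analyticAt (fun z => ?_) 0
    by_cases hz : z = 0
    · rw [hz]; exact hd.differentiableAt
    · have h2 : DifferentiableAt ℂ (fun z => z * riemannZeta (1 + z)) z := by
        refine differentiableAt_id.mul ?_
        exact (differentiableAt_riemannZeta (by simpa using hz)).comp z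
          (by fun_prop : DifferentiableAt ℂ (fun z : ℂ => 1 + z) z)
      refine h2.congr_of_eventuallyEq ?_
      filter_upwards [isOpen_ne.mem_nhds hz] with w hw
      exact hev w hw
  · filter_upwards [self_mem_nhdsWithin] with z hz
    exact (hev z hz).symm

/-! ### The coefficients as coefficients of a power series product -/

/-- The formal power series with coefficients `psCoeff k f`. -/
noncomputable def psSeries (f : ℂ → ℂ) : PowerSeries ℂ := PowerSeries.mk fun k => psCoeff k f

lemma coeff_psSeries (k : ℕ) (f : ℂ → ℂ) : PowerSeries.coeff k (psSeries f) = psCoeff k f :=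
  PowerSeries.coeff_mk _ _

lemma coeff_prod_eq_sum {ℓ n : ℕ} (h : n ≤ ℓ) (f : Fin ℓ → PowerSeries ℂ) :
    PowerSeries.coeff n (∏ j, f j) =
      ∑ k ∈ Fintype.piFinset (fun _ : Fin ℓ => Finset.range (ℓ + 1)),
        if ∑ j, k j = n then ∏ j, PowerSeries.coeff (k j) (f j) else 0 := by
  rw [PowerSeries.coeff_prod, ← Finset.sum_filter]
  refine Finset.sum_bij' (fun l _ => ⇑l) (fun k _ => Finsupp.equivFunOnFinite.symm k) ?_ ?_ ?_ ?_ ?_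
  · intro l hl
    rw [Finset.mem_finsuppAntidiag] at hl
    rw [Finset.mem_filter, Fintype.mem_piFinset]
    refine ⟨fun j => ?_, hl.1⟩
    have := Finset.single_le_sum (f := fun j => l j) (fun _ _ => Nat.zero_le _) (Finset.mem_univ j)
    rw [Finset.mem_range]
    have h2 : ∑ j, l j = n := hl.1
    omega
  · intro k hk
    rw [Finset.mem_filter] at hk
    rw [Finset.mem_finsuppAntidiag]
    exact ⟨hk.2, Finset.subset_univ _⟩
  · intro l _; ext; rfl
  · intro k _; rfl
  · intro l _; rfl

/-- The constraint on `p` and the `k j` is that of a Cauchy product, so the whole sum is one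
coefficient. All later evaluations reduce to counting the powers of `X` in this product. -/
lemma coeffC_eq {ℓ : ℕ} (α : Fin ℓ → ℂ) (a : ℂ) (b : ℕ) :
    coeffC α a b = 1 / (b ! : ℂ) * if b ≤ ℓ then
      PowerSeries.coeff (ℓ - b) (psSeries (fun z => z * Complex.Gamma (-a + z)) *
        ∏ j, psSeries (fun z => z * riemannZeta (-a + 1 - α j + z))) else 0 := by
  rw [coeffC]
  congr 1
  have key : ∀ p ∈ Finset.range (ℓ + 1),
      (∑ k ∈ Fintype.piFinset (fun _ : Fin ℓ => Finset.range (ℓ + 1)),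
        if b + p + ∑ j, k j = ℓ then
          psCoeff p (fun z => z * Complex.Gamma (-a + z)) *
            ∏ j, psCoeff (k j) (fun z => z * riemannZeta (-a + 1 - α j + z))
        else 0) = if b + p ≤ ℓ then psCoeff p (fun z => z * Complex.Gamma (-a + z)) *
          PowerSeries.coeff (ℓ - b - p)
            (∏ j, psSeries (fun z => z * riemannZeta (-a + 1 - α j + z))) else 0 := by
    intro p _
    split_ifs with h
    · rw [coeff_prod_eq_sum (by omega), Finset.mul_sum]
      refine Finset.sum_congr rfl fun k _ => ?_
      simp only [coeff_psSeries]
      by_cases h2 : ∑ j, k j = ℓ - b - p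
      · rw [if_pos h2, if_pos (by omega)]
      · rw [if_neg h2, if_neg (by omega), mul_zero]
    · exact Finset.sum_eq_zero fun k _ => if_neg (by omega)
  rw [Finset.sum_congr rfl key]
  split_ifs with hb
  · rw [PowerSeries.coeff_mul, Finset.Nat.sum_antidiagonal_eq_sum_range_succ_mk]
    symm
    rw [← Finset.sum_filter]
    refine Finset.sum_congr ?_ fun p _ => by rw [coeff_psSeries]
    ext p
    simp only [Finset.mem_range, Finset.mem_filter]
    omega
  · exact Finset.sum_eq_zero fun p _ => if_neg (by omega)

lemma coeff_X_pow_mul_add (d k : ℕ) (Q : PowerSeries ℂ) :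
    PowerSeries.coeff (d + k) (PowerSeries.X ^ d * Q) = PowerSeries.coeff k Q := by
  rw [add_comm, PowerSeries.coeff_X_pow_mul]

lemma coeff_X_pow_mul_of_lt {d k : ℕ} (h : k < d) (Q : PowerSeries ℂ) :
    PowerSeries.coeff k (PowerSeries.X ^ d * Q) = 0 := by
  rw [PowerSeries.coeff_X_pow_mul', if_neg (by omega)]

lemma coeff_zero_mul (P Q : PowerSeries ℂ) :
    PowerSeries.coeff 0 (P * Q) = PowerSeries.coeff 0 P * PowerSeries.coeff 0 Q := by
  simp only [PowerSeries.coeff_zero_eq_constantCoeff, map_mul]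

lemma constantCoeff_prod {ι : Type*} (u : Finset ι) (Y : ι → PowerSeries ℂ) :
    PowerSeries.coeff 0 (∏ i ∈ u, Y i) = ∏ i ∈ u, PowerSeries.coeff 0 (Y i) := by
  simp only [PowerSeries.coeff_zero_eq_constantCoeff, map_prod]

lemma coeff_one_prod {ι : Type*} [DecidableEq ι] (u : Finset ι) (Y : ι → PowerSeries ℂ) :
    PowerSeries.coeff 1 (∏ i ∈ u, Y i) =
      ∑ i ∈ u, PowerSeries.coeff 1 (Y i) * ∏ j ∈ u.erase i, PowerSeries.coeff 0 (Y j) := by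
  induction u using Finset.induction_on with
  | empty => simp [PowerSeries.coeff_one]
  | insert i u hi ih =>
    rw [Finset.prod_insert hi, PowerSeries.coeff_one_mul, ih, Finset.sum_insert hi,
      Finset.erase_insert hi, ← PowerSeries.coeff_zero_eq_constantCoeff_apply,
      ← PowerSeries.coeff_zero_eq_constantCoeff_apply, constantCoeff_prod, Finset.sum_mul]
    congr 1
    refine Finset.sum_congr rfl fun j hj => ?_
    have hij : j ≠ i := fun h => hi (h ▸ hj)
    rw [Finset.erase_insert_of_ne hij.symm, Finset.prod_insert (by simp [hi])]
    ring

lemma exists_eq_X_mul {P : PowerSeries ℂ} (h : PowerSeries.coeff 0 P = 0) :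
    ∃ Y, P = PowerSeries.X * Y ∧ ∀ k, PowerSeries.coeff k Y = PowerSeries.coeff (k + 1) P := by
  obtain ⟨Y, rfl⟩ := PowerSeries.X_dvd_iff.2 (by simpa using h)
  exact ⟨Y, rfl, fun k => by rw [PowerSeries.coeff_succ_X_mul]⟩

lemma exists_psSeries_zeta {c : ℂ} (hc : c ≠ 1) : ∃ Y : PowerSeries ℂ,
    psSeries (fun z => z * riemannZeta (c + z)) = PowerSeries.X * Y ∧
    PowerSeries.coeff 0 Y = riemannZeta c ∧ PowerSeries.coeff 1 Y = deriv riemannZeta c := by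
  have h := analyticAt_riemannZeta_add hc
  obtain ⟨Y, h1, h2⟩ := exists_eq_X_mul
    (P := psSeries (fun z => z * riemannZeta (c + z))) (by
      rw [coeff_psSeries, psCoeff_id_mul_zero h])
  refine ⟨Y, h1, ?_, ?_⟩
  · rw [h2, coeff_psSeries, psCoeff_id_mul_one h, add_zero]
  · rw [h2, coeff_psSeries, psCoeff_id_mul_two h, deriv_riemannZeta_add]

lemma coeffC_eq_of_eq_X_pow_mul {ℓ : ℕ} {α : Fin ℓ → ℂ} {a : ℂ} {Q : PowerSeries ℂ}
    (h : psSeries (fun z => z * Complex.Gamma (-a + z)) *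
        ∏ j, psSeries (fun z => z * riemannZeta (-a + 1 - α j + z)) = PowerSeries.X ^ ℓ * Q) (b : ℕ) :
    coeffC α a b = if b = 0 then PowerSeries.coeff 0 Q else 0 := by
  rw [coeffC_eq, h]
  rcases Nat.eq_zero_or_pos b with rfl | hb
  · simpa using coeff_X_pow_mul_add ℓ 0 Q
  · rw [if_neg hb.ne']
    split_ifs with h2
    · rw [coeff_X_pow_mul_of_lt (by omega), mul_zero]
    · rw [mul_zero]

/-- Gamma is singular and all zeta factors are regular: the product is divisible by `X ^ ℓ`, so only
`b = 0` survives. -/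
lemma coeffC_of_natCast {ℓ : ℕ} {α : Fin ℓ → ℂ} {a : ℕ} (hα : ∀ j, -(a : ℂ) + 1 - α j ≠ 1) (b : ℕ) :
    coeffC α a b = if b = 0 then
      (-1) ^ a / (a ! : ℂ) * ∏ j, riemannZeta (-(a : ℂ) + 1 - α j) else 0 := by
  choose Y hY hY0 _ using fun j => exists_psSeries_zeta (hα j)
  obtain ⟨g, hg, hev, h0, -⟩ := exists_Gamma_jet a
  rw [coeffC_eq_of_eq_X_pow_mul (Q := psSeries (fun z => z * Complex.Gamma (-(a : ℂ) + z)) * ∏ j, Y j)]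
  · simp only [coeff_zero_mul, constantCoeff_prod, hY0, coeff_psSeries,
      psCoeff_zero hev hg.continuousAt, h0]
  · simp_rw [hY, Finset.prod_mul_distrib]
    simp
    ring

lemma analyticAt_Gamma_add {a : ℂ} (ha : ∀ n : ℕ, a ≠ n) :
    AnalyticAt ℂ (fun z => Complex.Gamma (-a + z)) 0 := by
  have h : ∀ m : ℕ, -a ≠ -m := fun m h => ha m (neg_injective h)
  refine AnalyticAt.fun_comp (g := Complex.Gamma) ?_ (by fun_prop)
  rw [add_zero]
  exact analyticAt_Gamma h

/-- One zeta factor is singular, so it loses its `X`, but gamma is regular and supplies one; the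
total is again `X ^ ℓ`. -/
lemma coeffC_of_pole {ℓ : ℕ} {α : Fin ℓ → ℂ} {a : ℂ} (ha : ∀ n : ℕ, a ≠ n) {i : Fin ℓ}
    (hi : -a + 1 - α i = 1) (hα : ∀ j, j ≠ i → -a + 1 - α j ≠ 1) (b : ℕ) :
    coeffC α a b = if b = 0 then
      Complex.Gamma (-a) * ∏ j ∈ Finset.univ.erase i, riemannZeta (-a + 1 - α j) else 0 := by
  choose! Y hY hY0 _ using fun j => fun hj => exists_psSeries_zeta (hα j hj)
  obtain ⟨g, hg, hev, h0, -⟩ := exists_zeta_jet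
  have hΓ := analyticAt_Gamma_add ha
  obtain ⟨G, hG, hG0⟩ := exists_eq_X_mul
    (P := psSeries (fun z => z * Complex.Gamma (-a + z))) (by
      rw [coeff_psSeries, psCoeff_id_mul_zero hΓ])
  have hℓ : (PowerSeries.X : PowerSeries ℂ) ^ ℓ = PowerSeries.X ^ (ℓ - 1) * PowerSeries.X := by
    rw [← pow_succ]
    congr 1
    have := i.2
    omega
  rw [coeffC_eq_of_eq_X_pow_mul (Q := G * (psSeries (fun z => z * riemannZeta (1 + z)) *
    ∏ j ∈ Finset.univ.erase i, Y j))]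
  · simp only [coeff_zero_mul, constantCoeff_prod, coeff_psSeries, hG0,
      psCoeff_zero hev hg.continuousAt, h0, one_mul, zero_add, psCoeff_id_mul_one hΓ, add_zero]
    congr 2
    exact Finset.prod_congr rfl fun j hj => hY0 j (Finset.ne_of_mem_erase hj)
  · rw [← Finset.mul_prod_erase _ _ (Finset.mem_univ i), hi, hG,
      Finset.prod_congr rfl fun j hj => hY j (Finset.ne_of_mem_erase hj), Finset.prod_mul_distrib]
    simp only [Finset.prod_const, Finset.card_erase_of_mem (Finset.mem_univ i), Finset.card_univ,
      Fintype.card_fin]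
    rw [hℓ]
    ring

/-- Gamma and one zeta factor are both singular, leaving only `X ^ (ℓ - 1)`: `b = 1` reads the
constant term of the cofactor and `b = 0` its linear term, by the Leibniz rule. -/
lemma coeffC_of_natCast_of_pole {ℓ : ℕ} {α : Fin ℓ → ℂ} {a : ℕ} {i : Fin ℓ}
    (hi : -(a : ℂ) + 1 - α i = 1) (hα : ∀ j, j ≠ i → -(a : ℂ) + 1 - α j ≠ 1) :
    coeffC α a 1 = (-1) ^ a / (a ! : ℂ) *
      ∏ j ∈ Finset.univ.erase i, riemannZeta (-(a : ℂ) + 1 - α j) ∧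
    coeffC α a 0 = (-1) ^ a / (a ! : ℂ) * (((harmonic a : ℚ) : ℂ) *
      ∏ j ∈ Finset.univ.erase i, riemannZeta (-(a : ℂ) + 1 - α j) +
      ∑ j ∈ Finset.univ.erase i, deriv riemannZeta (-(a : ℂ) + 1 - α j) *
        ∏ r ∈ (Finset.univ.erase i).erase j, riemannZeta (-(a : ℂ) + 1 - α r)) ∧
    ∀ b, 2 ≤ b → coeffC α a b = 0 := by
  choose! Y hY hY0 hY1 using fun j => fun hj => exists_psSeries_zeta (hα j hj)
  obtain ⟨g, hg, hev, h0, h1⟩ := exists_zeta_jet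
  obtain ⟨γ, hγ, hγev, hγ0, hγ1⟩ := exists_Gamma_jet a
  have hℓ : ℓ = (ℓ - 1) + 1 := by have := i.2; omega
  set G := psSeries (fun z => z * Complex.Gamma (-(a : ℂ) + z)) with hGdef
  set P := psSeries (fun z => z * riemannZeta (1 + z)) with hPdef
  have hG0 : PowerSeries.coeff 0 G = (-1) ^ a / (a ! : ℂ) := by
    rw [hGdef, coeff_psSeries, psCoeff_zero hγev hγ.continuousAt, hγ0]
  have hG1 := (coeff_psSeries 1 _).trans (psCoeff_one hγev hγ1)
  rw [← hGdef] at hG1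
  have hP0 : PowerSeries.coeff 0 P = 1 := by
    rw [hPdef, coeff_psSeries, psCoeff_zero hev hg.continuousAt, h0]
  have hP1 := (coeff_psSeries 1 _).trans (psCoeff_one hev h1)
  rw [← hPdef] at hP1
  have hprod : G * ∏ j, psSeries (fun z => z * riemannZeta (-(a : ℂ) + 1 - α j + z)) =
      PowerSeries.X ^ (ℓ - 1) * (G * P * ∏ j ∈ Finset.univ.erase i, Y j) := by
    rw [← Finset.mul_prod_erase _ _ (Finset.mem_univ i), hi,
      Finset.prod_congr rfl fun j hj => hY j (Finset.ne_of_mem_erase hj), Finset.prod_mul_distrib]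
    simp only [Finset.prod_const, Finset.card_erase_of_mem (Finset.mem_univ i), Finset.card_univ,
      Fintype.card_fin]
    ring
  have hY0' : ∀ s ⊆ Finset.univ.erase i, ∏ j ∈ s, PowerSeries.coeff 0 (Y j) =
      ∏ j ∈ s, riemannZeta (-(a : ℂ) + 1 - α j) := fun s hs =>
    Finset.prod_congr rfl fun j hj => hY0 j (Finset.ne_of_mem_erase (hs hj))
  refine ⟨?_, ?_, fun b hb => ?_⟩
  · rw [coeffC_eq, hprod, if_pos (by omega)]
    have := coeff_X_pow_mul_add (ℓ - 1) 0 (G * P * ∏ j ∈ Finset.univ.erase i, Y j)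
    rw [add_zero] at this
    rw [this, coeff_zero_mul, coeff_zero_mul, constantCoeff_prod, hG0, hP0,
      hY0' _ subset_rfl]
    simp
  · rw [coeffC_eq, hprod, if_pos (Nat.zero_le _), Nat.sub_zero]
    have := coeff_X_pow_mul_add (ℓ - 1) 1 (G * P * ∏ j ∈ Finset.univ.erase i, Y j)
    rw [← hℓ] at this
    simp only [this, PowerSeries.coeff_one_mul, ← PowerSeries.coeff_zero_eq_constantCoeff_apply,
      coeff_zero_mul, constantCoeff_prod, coeff_one_prod, hG0, hG1, hP0, hP1,
      hY0' _ subset_rfl]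
    rw [Finset.sum_congr rfl fun j hj => by
      rw [hY1 j (Finset.ne_of_mem_erase hj), hY0' _ (Finset.erase_subset _ _)]]
    simp only [Nat.factorial_zero, Nat.cast_one, div_one]
    -- Euler's constant cancels here: it enters with a minus sign from gamma and a plus sign from
    -- zeta.
    ring
  · rw [coeffC_eq, hprod]
    split_ifs
    · rw [coeff_X_pow_mul_of_lt (by omega), mul_zero]
    · rw [mul_zero]

/-! ### Principal parts of the Mellin transform -/

/-- The Mellin transform of `Z α`. -/
noncomputable def mellinZ {ℓ : ℕ} (α : Fin ℓ → ℂ) (s : ℂ) : ℂ :=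
  Complex.Gamma s * ∏ j, riemannZeta (s + 1 - α j)

lemma mellinZ_neg_add {ℓ : ℕ} (α : Fin ℓ → ℂ) (a z : ℂ) :
    mellinZ α (-a + z) = Complex.Gamma (-a + z) * ∏ j, riemannZeta (-a + 1 - α j + z) := by
  rw [mellinZ]
  congr 1
  exact Finset.prod_congr rfl fun j _ => by ring_nf

lemma mellinZ_neg_add_of_pole {ℓ : ℕ} {α : Fin ℓ → ℂ} {a : ℂ} {i : Fin ℓ}
    (hi : -a + 1 - α i = 1) (z : ℂ) :
    mellinZ α (-a + z) = Complex.Gamma (-a + z) * (riemannZeta (1 + z) *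
      ∏ j ∈ Finset.univ.erase i, riemannZeta (-a + 1 - α j + z)) := by
  rw [mellinZ_neg_add, ← Finset.mul_prod_erase _ _ (Finset.mem_univ i), hi]

/-- `C_{a,1} / (s + a) ^ 2 + C_{a,0} / (s + a)` is the principal part of `mellinZ α` at `-a`. -/
def HasPrincipalPart {ℓ : ℕ} (α : Fin ℓ → ℂ) (a : ℂ) : Prop :=
  ∃ u : ℂ → ℂ, AnalyticAt ℂ u 0 ∧ (fun z => z ^ 2 * mellinZ α (-a + z)) =ᶠ[𝓝[≠] 0] u ∧
    u 0 = coeffC α a 1 ∧ HasDerivAt u (coeffC α a 0) 0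

lemma analyticAt_prod_zeta {ι : Type*} (u : Finset ι) {c : ι → ℂ} (h : ∀ j ∈ u, c j ≠ 1) :
    AnalyticAt ℂ (fun z => ∏ j ∈ u, riemannZeta (c j + z)) 0 :=
  Finset.analyticAt_fun_prod u fun j hj => analyticAt_riemannZeta_add (h j hj)

lemma hasPrincipalPart_of_natCast {ℓ : ℕ} {α : Fin ℓ → ℂ} {a : ℕ}
    (hα : ∀ j, -(a : ℂ) + 1 - α j ≠ 1) : HasPrincipalPart α a := by
  obtain ⟨g, hg, hev, h0, -⟩ := exists_Gamma_jet a
  have hP := analyticAt_prod_zeta Finset.univ (c := fun j => -(a : ℂ) + 1 - α j) fun j _ => hα j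
  have hgP := hg.fun_mul hP
  refine ⟨fun z => z * (g z * ∏ j, riemannZeta (-(a : ℂ) + 1 - α j + z)),
    analyticAt_id.fun_mul hgP, ?_, ?_, ?_⟩
  · filter_upwards [hev] with z hz
    rw [← hz, mellinZ_neg_add]
    ring
  · rw [coeffC_of_natCast hα, if_neg one_ne_zero]
    exact zero_mul _
  · rw [coeffC_of_natCast hα, if_pos rfl]
    refine (hasDerivAt_id_mul hgP.differentiableAt).congr_deriv ?_
    simp [h0]

lemma hasPrincipalPart_of_pole {ℓ : ℕ} {α : Fin ℓ → ℂ} {a : ℂ} (ha : ∀ n : ℕ, a ≠ n) {i : Fin ℓ}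
    (hi : -a + 1 - α i = 1) (hα : ∀ j, j ≠ i → -a + 1 - α j ≠ 1) : HasPrincipalPart α a := by
  obtain ⟨g, hg, hev, h0, -⟩ := exists_zeta_jet
  have hP := analyticAt_prod_zeta (Finset.univ.erase i) (c := fun j => -a + 1 - α j)
    fun j hj => hα j (Finset.ne_of_mem_erase hj)
  have hgP := (analyticAt_Gamma_add ha).fun_mul (hg.fun_mul hP)
  refine ⟨fun z => z * (Complex.Gamma (-a + z) *
    (g z * ∏ j ∈ Finset.univ.erase i, riemannZeta (-a + 1 - α j + z))),
    analyticAt_id.fun_mul hgP, ?_, ?_, ?_⟩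
  · filter_upwards [hev] with z hz
    rw [← hz, mellinZ_neg_add_of_pole hi]
    ring
  · rw [coeffC_of_pole ha hi hα, if_neg one_ne_zero]
    exact zero_mul _
  · rw [coeffC_of_pole ha hi hα, if_pos rfl]
    refine (hasDerivAt_id_mul hgP.differentiableAt).congr_deriv ?_
    simp [h0]

lemma hasPrincipalPart_of_natCast_of_pole {ℓ : ℕ} {α : Fin ℓ → ℂ} {a : ℕ} {i : Fin ℓ}
    (hi : -(a : ℂ) + 1 - α i = 1) (hα : ∀ j, j ≠ i → -(a : ℂ) + 1 - α j ≠ 1) :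
    HasPrincipalPart α a := by
  obtain ⟨g, hg, hev, h0, h1⟩ := exists_zeta_jet
  obtain ⟨γ, hγ, hγev, hγ0, hγ1⟩ := exists_Gamma_jet a
  obtain ⟨hC1, hC0, -⟩ := coeffC_of_natCast_of_pole hi hα
  have hne : ∀ j ∈ Finset.univ.erase i, -(a : ℂ) + 1 - α j ≠ 1 :=
    fun j hj => hα j (Finset.ne_of_mem_erase hj)
  have hP := analyticAt_prod_zeta (Finset.univ.erase i) (c := fun j => -(a : ℂ) + 1 - α j) hne
  refine ⟨fun z => (γ z * g z) * ∏ j ∈ Finset.univ.erase i, riemannZeta (-(a : ℂ) + 1 - α j + z),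
    (hγ.fun_mul hg).fun_mul hP, ?_, ?_, ?_⟩
  · filter_upwards [hev, hγev] with z hz hz2
    rw [← hz, ← hz2, mellinZ_neg_add_of_pole hi]
    ring
  · simp [hC1, hγ0, h0]
  · have hd := HasDerivAt.fun_finsetProd (u := Finset.univ.erase i)
      (f := fun j z => riemannZeta (-(a : ℂ) + 1 - α j + z))
      fun j hj => (analyticAt_riemannZeta_add (hne j hj)).differentiableAt.hasDerivAt
    refine ((hγ1.fun_mul h1).fun_mul hd).congr_deriv ?_
    simp only [deriv_riemannZeta_add, add_zero, smul_eq_mul, hγ0, h0, hC0]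
    rw [Finset.sum_congr rfl fun j _ => mul_comm _ _]
    ring

/-- Subtracting the principal part leaves an analytic function. -/
lemma HasPrincipalPart.exists_analyticAt {ℓ : ℕ} {α : Fin ℓ → ℂ} {a : ℂ}
    (h : HasPrincipalPart α a) : ∃ g : ℂ → ℂ, AnalyticAt ℂ g (-a) ∧
      (fun s => mellinZ α s - (coeffC α a 0 * (1 / (s + a)) + coeffC α a 1 * (1 / (s + a) ^ 2)))
        =ᶠ[𝓝[≠] (-a)] g := by
  obtain ⟨u, hu, hev, h0, h1⟩ := h
  have hds : ∀ {f : ℂ → ℂ}, AnalyticAt ℂ f 0 → AnalyticAt ℂ (dslope f 0) 0 := fun hf =>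
    hf.choose_spec.has_fpower_series_dslope_fslope.analyticAt
  -- The second divided difference of `u`, that is, the analytic remainder after its constant and
  -- linear terms; divided by `(s + a)²`, those two terms are the principal part.
  set v := dslope (dslope u 0) 0 with hv
  have hvu : ∀ z, u z = u 0 + coeffC α a 0 * z + z ^ 2 * v z := by
    intro z
    have e1 := sub_smul_dslope u 0 z
    have e2 := sub_smul_dslope (dslope u 0) 0 z
    rw [dslope_same, h1.deriv, ← hv] at e2
    simp only [sub_zero, smul_eq_mul] at e1 e2
    linear_combination -e1 - z * e2
  refine ⟨fun s => v (s + a), ?_, ?_⟩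
  · refine AnalyticAt.fun_comp (g := v) ?_ (by fun_prop)
    rw [neg_add_cancel]
    exact hds (hds hu)
  · have ht : Tendsto (fun s : ℂ => s + a) (𝓝[≠] (-a)) (𝓝[≠] 0) := by
      refine tendsto_nhdsWithin_iff.2 ⟨?_, ?_⟩
      · have : Tendsto (fun s : ℂ => s + a) (𝓝 (-a)) (𝓝 (-a + a)) :=
          (by fun_prop : Continuous fun s : ℂ => s + a).tendsto (-a)
        rw [neg_add_cancel] at this
        exact this.mono_left nhdsWithin_le_nhds
      · filter_upwards [self_mem_nhdsWithin] with s hs h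
        exact hs (eq_neg_of_add_eq_zero_left h)
    filter_upwards [ht.eventually hev, self_mem_nhdsWithin] with s hs hs2
    have hne : s + a ≠ 0 := fun h => hs2 (eq_neg_of_add_eq_zero_left h)
    rw [hvu, h0, show -a + (s + a) = s by ring] at hs
    field_simp
    linear_combination hs

/-- Filling in removable singularities. -/
lemma analyticAt_limUnder {H g : ℂ → ℂ} {s : ℂ} (hg : AnalyticAt ℂ g s) (h : H =ᶠ[𝓝[≠] s] g) :
    AnalyticAt ℂ (fun s => limUnder (𝓝[≠] s) H) s := by
  refine hg.congr ?_
  rw [EventuallyEq, eventually_nhdsWithin_iff] at h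
  filter_upwards [hg.eventually_analyticAt, h.eventually_nhds] with z hz hz2
  symm
  refine Tendsto.limUnder_eq ?_
  refine (hz.continuousAt.tendsto.mono_left nhdsWithin_le_nhds).congr' ?_
  by_cases hzs : z = s
  · subst hzs
    filter_upwards [nhdsWithin_le_nhds hz2, self_mem_nhdsWithin] with w hw hw2
    exact (hw hw2).symm
  · filter_upwards [nhdsWithin_le_nhds hz2, nhdsWithin_le_nhds (isOpen_ne.mem_nhds hzs)] with w hw hw2
    exact (hw hw2).symm

lemma limUnder_eq_of_continuousAt {H : ℂ → ℂ} {s : ℂ} (h : ContinuousAt H s) :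
    limUnder (𝓝[≠] s) H = H s :=
  (h.tendsto.mono_left nhdsWithin_le_nhds).limUnder_eq

lemma analyticAt_mellinZ {ℓ : ℕ} {α : Fin ℓ → ℂ} {s : ℂ} (h1 : ∀ n : ℕ, s ≠ -n)
    (h2 : ∀ j, s ≠ α j) : AnalyticAt ℂ (mellinZ α) s := by
  refine (analyticAt_Gamma h1).fun_mul (Finset.analyticAt_fun_prod _ fun j _ => ?_)
  refine AnalyticAt.fun_comp (g := riemannZeta) (analyticAt_riemannZeta fun h => h2 j ?_) (by fun_prop)
  linear_combination h

/-! ### The multiple sum as an inverse Mellin transform -/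

lemma prod_cpow {ι : Type*} (u : Finset ι) (δ : ι → ℕ+) (s : ℂ) :
    ((∏ j ∈ u, ((δ j : ℕ) : ℝ) : ℝ) : ℂ) ^ s = ∏ j ∈ u, ((δ j : ℕ) : ℂ) ^ s := by
  classical
  induction u using Finset.induction_on with
  | empty => simp
  | insert i u hi ih =>
    rw [Finset.prod_insert hi, Finset.prod_insert hi, ← ih, Complex.ofReal_mul,
      Complex.mul_cpow_ofReal_nonneg (Nat.cast_nonneg _) (Finset.prod_nonneg fun _ _ => Nat.cast_nonneg _)]
    simp

lemma hasSum_zeta_pnat {s : ℂ} (hs : 1 < s.re) :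
    HasSum (fun n : ℕ+ => ((n : ℕ) : ℂ) ^ (-s)) (riemannZeta s) := by
  rw [← Equiv.pnatEquivNat.symm.hasSum_iff]
  refine (hasSum_zeta hs).congr_fun fun n => ?_
  simp [Function.comp, Complex.cpow_neg]

/-- `Z α` as an inverse Mellin transform. -/
lemma hasSum_term {ℓ : ℕ} {α : Fin ℓ → ℂ} {σ t : ℝ} (hσ : 0 < σ) (ht : 0 < t)
    (hα : ∀ j, (α j).re < σ) : HasSum (term α t) (mellinInv σ (mellinZ α) t) := by
  have key : ∀ s : ℂ, s.re = σ → HasSum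
      (fun δ : Fin ℓ → ℕ+ => (∏ j, ((δ j : ℕ) : ℂ) ^ (α j - 1)) *
        ((∏ j, ((δ j : ℕ) : ℝ) : ℝ) : ℂ) ^ (-s)) (∏ j, riemannZeta (s + 1 - α j)) := by
    intro s hs
    have h := hasSum_prod (f := fun (j : Fin ℓ) (n : ℕ+) => ((n : ℕ) : ℂ) ^ (-(s + 1 - α j)))
      (fun j => hasSum_zeta_pnat (by simp; linarith [hα j]))
    refine h.congr_fun fun δ => ?_
    rw [prod_cpow, ← Finset.prod_mul_distrib]
    refine Finset.prod_congr rfl fun j _ => ?_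
    rw [← Complex.cpow_add _ _ (by exact_mod_cast (δ j).ne_zero)]
    congr 1
    ring
  have hp : ∀ δ : Fin ℓ → ℕ+, 0 < ∏ j, ((δ j : ℕ) : ℝ) := fun δ =>
    Finset.prod_pos fun j _ => by exact_mod_cast (δ j).pos
  have h := hasSum_mellinInv hσ ht hp key ?_
  · refine h.congr_fun fun δ => ?_
    rw [term]
    push_cast
    ring_nf
  · refine (key σ (by simp)).summable.norm.congr fun δ => ?_
    rw [norm_mul, Complex.norm_cpow_eq_rpow_re_of_pos (hp δ)]
    simp

lemma polyBddOn_prod_zeta {ℓ : ℕ} {α : Fin ℓ → ℂ} (hα : ∀ j, (α j).im = 0) (a b : ℝ) :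
    PolyBddOn (fun s => ∏ j, riemannZeta (s + 1 - α j))
      {s | a ≤ s.re ∧ s.re ≤ b ∧ 1 ≤ |s.im|} := by
  refine PolyBddOn.prod (F := fun j s => riemannZeta (s + 1 - α j)) _ fun j _ => ?_
  obtain ⟨k, hk⟩ := exists_nat_ge (1 - a + (α j).re)
  have h := (polyBddOn_riemannZeta k).comp_add
    (S := {s | a ≤ s.re ∧ s.re ≤ b ∧ 1 ≤ |s.im|})
    (fun s hs => one_le_norm_of_one_le_abs_im hs.2.2) (1 - α j) fun s hs => ⟨?_, ?_⟩
  · simpa only [add_sub_assoc] using h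
  · have := hs.1
    simp
    linarith
  · simpa [hα j] using hs.2.2

/-! ### Poles for the staircase parameters -/

lemma neg_add_one_sub_staircase (ℓ : ℕ) (m a : ℤ) (j : Fin ℓ) :
    -(a : ℂ) + 1 - staircase ℓ m j = ((-a - m + ((j : ℕ) + 1 : ℤ) : ℤ) : ℂ) := by
  rw [staircase]
  push_cast
  ring

lemma neg_add_one_sub_staircase_eq_one {ℓ : ℕ} {m a : ℤ} {j : Fin ℓ} :
    -(a : ℂ) + 1 - staircase ℓ m j = 1 ↔ ((j : ℕ) : ℤ) = a + m := by
  rw [neg_add_one_sub_staircase]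
  norm_cast
  omega

lemma mem_S_iff {ℓ : ℕ} {m a : ℤ} : a ∈ S ℓ m ↔ ∃ j : Fin ℓ, ((j : ℕ) : ℤ) = a + m := by
  rw [S, Finset.mem_Icc]
  constructor
  · rintro ⟨h1, h2⟩
    exact ⟨⟨(a + m).toNat, by omega⟩, by simp; omega⟩
  · rintro ⟨j, hj⟩
    have := j.2
    omega

/-- The entries of the staircase are distinct, so no second zeta factor is singular at the same
point; hence no pole has order above two. -/
lemma neg_add_one_sub_staircase_ne_one {ℓ : ℕ} {m a : ℤ} {i : Fin ℓ} (hi : ((i : ℕ) : ℤ) = a + m)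
    (j : Fin ℓ) (hj : j ≠ i) : -(a : ℂ) + 1 - staircase ℓ m j ≠ 1 := by
  rw [Ne, neg_add_one_sub_staircase_eq_one, ← hi]
  intro h
  exact hj (Fin.ext (by exact_mod_cast h))

lemma intCast_ne_natCast {a : ℤ} (ha : a < 0) (n : ℕ) : (a : ℂ) ≠ n := by
  intro h
  have : a = (n : ℤ) := by exact_mod_cast h
  omega

lemma hasPrincipalPart_staircase {ℓ : ℕ} {m a : ℤ} (h : 0 ≤ a ∨ a ∈ S ℓ m) :
    HasPrincipalPart (staircase ℓ m) (a : ℂ) := by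
  by_cases hS : a ∈ S ℓ m
  · obtain ⟨i, hi⟩ := mem_S_iff.1 hS
    have h1 := neg_add_one_sub_staircase_eq_one.2 hi
    have h2 := neg_add_one_sub_staircase_ne_one hi
    rcases lt_or_ge a 0 with ha | ha
    · exact hasPrincipalPart_of_pole (intCast_ne_natCast ha) h1 h2
    · lift a to ℕ using ha
      push_cast at h1 h2 ⊢
      exact hasPrincipalPart_of_natCast_of_pole h1 h2
  · have ha : 0 ≤ a := h.resolve_right hS
    lift a to ℕ using ha
    push_cast
    refine hasPrincipalPart_of_natCast fun j hj => hS (mem_S_iff.2 ⟨j, ?_⟩)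
    exact neg_add_one_sub_staircase_eq_one.1 (by exact_mod_cast hj)

lemma mem_exponentsUpTo {ℓ : ℕ} {m : ℤ} {N : ℕ} {a : ℤ} :
    a ∈ exponentsUpTo ℓ m N ↔ (0 ≤ a ∨ a ∈ S ℓ m) ∧ a ≤ N := by
  simp only [exponentsUpTo, Finset.mem_union, Finset.mem_Icc, Finset.mem_filter]
  tauto

/-! ### Subtracting the principal parts and shifting the line -/

/-- The principal part at `-a`, modified by a pole at `-B` so that it decays quadratically. -/
noncomputable def principal {ℓ : ℕ} (α : Fin ℓ → ℂ) (B : ℝ) (a : ℤ) (s : ℂ) : ℂ :=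
  coeffC α a 0 * (1 / (s + (a : ℝ)) - 1 / (s + B)) + coeffC α a 1 * (1 / (s + (a : ℝ)) ^ 2)

lemma analyticAt_one_div_add {s c : ℂ} (h : s + c ≠ 0) : AnalyticAt ℂ (fun s => 1 / (s + c)) s :=
  analyticAt_const.fun_div (by fun_prop) h

lemma analyticAt_principal {ℓ : ℕ} (α : Fin ℓ → ℂ) {B : ℝ} {a : ℤ} {s : ℂ} (h1 : s ≠ -(a : ℂ))
    (h2 : s + B ≠ 0) : AnalyticAt ℂ (principal α B a) s := by
  have h3 : s + ((a : ℝ) : ℂ) ≠ 0 := fun h => h1 (by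
    push_cast at h
    linear_combination h)
  refine (analyticAt_const.fun_mul ((analyticAt_one_div_add h3).fun_sub
    (analyticAt_one_div_add h2))).fun_add (analyticAt_const.fun_mul ?_)
  exact analyticAt_const.fun_div (by fun_prop) (pow_ne_zero 2 h3)

lemma norm_principal_le {ℓ : ℕ} (α : Fin ℓ → ℂ) (B : ℝ) (a : ℤ) {s : ℂ} (h : s.im ≠ 0) :
    ‖principal α B a s‖ ≤ (‖coeffC α a 0‖ * |B - a| + ‖coeffC α a 1‖) / s.im ^ 2 := by
  refine (norm_add_le _ _).trans ?_
  rw [norm_mul, norm_mul, add_div, mul_div_assoc, ← mul_one_div ‖coeffC α a 1‖]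
  gcongr
  · exact norm_one_div_sub_le s a B h
  · exact norm_one_div_sq_le s a h

lemma verticalIntegrable_principal {ℓ : ℕ} (α : Fin ℓ → ℂ) {B σ : ℝ} {a : ℤ} (ha : 0 < σ + a)
    (hB : 0 < σ + B) : Complex.VerticalIntegrable (principal α B a) σ :=
  ((verticalIntegrable_one_div_sub ha hB).const_mul _).add
    ((verticalIntegrable_one_div_sq ha).const_mul _)

lemma mellinInv_principal {ℓ : ℕ} (α : Fin ℓ → ℂ) {B σ x : ℝ} {a : ℤ} (ha : 0 < σ + a)
    (hB : 0 < σ + B) (h0 : 0 < x) (h1 : x < 1) :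
    mellinInv σ (principal α B a) x =
      coeffC α a 0 * ((x : ℂ) ^ a - (x : ℂ) ^ (B : ℂ)) +
      coeffC α a 1 * ((x : ℂ) ^ a * ((-Real.log x : ℝ) : ℂ)) := by
  have e := mellinInv_sub (f := fun s => coeffC α a 0 * (1 / (s + (a : ℝ)) - 1 / (s + B)))
    (g := fun s => (-coeffC α a 1) * (1 / (s + (a : ℝ)) ^ 2))
    ((verticalIntegrable_one_div_sub ha hB).const_mul _)
    ((verticalIntegrable_one_div_sq ha).const_mul _) h0
  have e2 : principal α B a = fun s => coeffC α a 0 * (1 / (s + (a : ℝ)) - 1 / (s + B)) -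
      (-coeffC α a 1) * (1 / (s + (a : ℝ)) ^ 2) := by
    ext s
    rw [principal]
    ring
  rw [e2, e, mellinInv_const_mul, mellinInv_const_mul, mellinInv_one_div_sub ha hB h0 h1,
    mellinInv_one_div_sq ha h0 h1, Complex.ofReal_intCast, Complex.cpow_intCast]
  ring

lemma exists_analyticAt_regularPart {ℓ : ℕ} {m : ℤ} {N : ℕ} {B : ℝ} {a : ℤ}
    (ha : a ∈ exponentsUpTo ℓ m N) (hB : (a : ℝ) < B) :
    ∃ g : ℂ → ℂ, AnalyticAt ℂ g (-(a : ℂ)) ∧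
      (fun s => mellinZ (staircase ℓ m) s -
        ∑ a ∈ exponentsUpTo ℓ m N, principal (staircase ℓ m) B a s) =ᶠ[𝓝[≠] (-(a : ℂ))] g := by
  obtain ⟨g, hg, hev⟩ := (hasPrincipalPart_staircase (mem_exponentsUpTo.1 ha).1).exists_analyticAt
  have hBa : -(a : ℂ) + B ≠ 0 := by
    intro h
    have := congrArg Complex.re h
    simp at this
    linarith
  -- The compensating fraction with pole at `-B` is added back, and the principal parts at the other
  -- exponents are analytic at `-a`.
  refine ⟨fun s => g s + coeffC (staircase ℓ m) a 0 * (1 / (s + B)) -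
    ∑ b ∈ (exponentsUpTo ℓ m N).erase a, principal (staircase ℓ m) B b s, ?_, ?_⟩
  · refine (hg.fun_add (analyticAt_const.fun_mul (analyticAt_one_div_add hBa))).fun_sub
      (Finset.analyticAt_fun_sum _ fun b hb => analyticAt_principal _ (fun h => ?_) hBa)
    refine Finset.ne_of_mem_erase hb ?_
    exact_mod_cast (neg_injective h).symm
  · filter_upwards [hev] with s hs
    rw [← hs, ← Finset.add_sum_erase _ _ ha, principal]
    push_cast
    ring

/-- The possible poles of `mellinZ` are integers `-a` with `a ∈ ℕ ∪ S`. To the right of `-(N + 1)`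
these have `a ≤ N`, so all of them are listed in `exponentsUpTo`. -/
lemma analyticAt_regularPart {ℓ : ℕ} {m : ℤ} {N : ℕ} {s : ℂ} (hre : -((N : ℝ) + 1) < s.re)
    (hs : ∀ a ∈ exponentsUpTo ℓ m N, s ≠ -(a : ℂ)) :
    AnalyticAt ℂ (fun s => mellinZ (staircase ℓ m) s -
      ∑ a ∈ exponentsUpTo ℓ m N, principal (staircase ℓ m) (N + 1 : ℝ) a s) s := by
  have hB : s + ((N + 1 : ℝ) : ℂ) ≠ 0 := by
    intro h
    have := congrArg Complex.re h
    simp at this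
    linarith
  have hle : ∀ a : ℤ, s = -(a : ℂ) → a ≤ N := by
    rintro a rfl
    have h1 : (a : ℝ) < ((N + 1 : ℤ) : ℝ) := by
      push_cast
      simpa using hre
    have h2 : a < N + 1 := by exact_mod_cast h1
    omega
  refine (analyticAt_mellinZ (fun n h => ?_) fun j h => ?_).fun_sub
    (Finset.analyticAt_fun_sum _ fun a ha => analyticAt_principal _ (hs a ha) hB)
  · have h' : s = -((n : ℤ) : ℂ) := by exact_mod_cast h
    exact hs n (mem_exponentsUpTo.2 ⟨Or.inl (by omega), hle _ h'⟩) h'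
  · have h' : s = -(((j : ℕ) - m : ℤ) : ℂ) := by
      rw [h, staircase]
      push_cast
      ring
    exact hs _ (mem_exponentsUpTo.2 ⟨Or.inr (mem_S_iff.2 ⟨j, by ring⟩), hle _ h'⟩) h'

lemma staircase_re (ℓ : ℕ) (m : ℤ) (j : Fin ℓ) : (staircase ℓ m j).re = m - (j : ℕ) := by
  simp [staircase]

lemma staircase_im (ℓ : ℕ) (m : ℤ) (j : Fin ℓ) : (staircase ℓ m j).im = 0 := by
  simp [staircase]

lemma verticalIntegrable_mellinZ {ℓ : ℕ} {m : ℤ} {σ : ℝ} (h0 : 0 < σ) (hσ : (m : ℝ) < σ) :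
    Complex.VerticalIntegrable (mellinZ (staircase ℓ m)) σ := by
  obtain ⟨C, hC⟩ := (polyBddOn_prod_zeta (staircase_im ℓ m) σ σ).norm_Gamma_mul_le
  refine integrable_of_le_div_sq (C := C) ?_ fun y hy => ?_
  · rw [continuous_iff_continuousAt]
    intro y
    refine ContinuousAt.comp (g := mellinZ (staircase ℓ m)) ?_ (continuous_vertical σ).continuousAt
    refine (analyticAt_mellinZ (fun n h => ?_) fun j h => ?_).continuousAt
    · have := congrArg Complex.re h
      simp at this
      linarith [(Nat.cast_nonneg n : (0 : ℝ) ≤ n)]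
    · have := congrArg Complex.re h
      rw [staircase_re] at this
      simp at this
      linarith [(Nat.cast_nonneg (j : ℕ) : (0 : ℝ) ≤ (j : ℕ))]
  · have h := hC (σ + y * Complex.I) (by simp) (by simp) (by simpa using hy)
    rwa [show ((σ : ℂ) + y * Complex.I).im = y by simp] at h

/-- The remainder of the truncated expansion, as an inverse Mellin transform on a line to the left of
the poles. -/
lemma exists_mellinInv_remainder (ℓ : ℕ) (m : ℤ) (N : ℕ) : ∃ H : ℂ → ℂ, ∀ x : ℝ, 0 < x → x < 1 →
    Z (staircase ℓ m) x - ∑ a ∈ exponentsUpTo ℓ m N, ∑ b ∈ ({0, 1} : Finset ℕ),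
      coeffC (staircase ℓ m) (a : ℂ) b * (x : ℂ) ^ a * ((-Real.log x : ℝ) : ℂ) ^ b =
    mellinInv (-(N + 1 / 2 : ℝ)) H x -
      (∑ a ∈ exponentsUpTo ℓ m N, coeffC (staircase ℓ m) (a : ℂ) 0) *
        (x : ℂ) ^ ((N + 1 : ℝ) : ℂ) := by
  set α := staircase ℓ m
  set E := exponentsUpTo ℓ m N
  -- The auxiliary pole at `-(N + 1)` lies left of the final line `-(N + 1/2)`, and its contribution
  -- `x^(N+1)` is negligible at order `N`.
  set B : ℝ := N + 1 with hB
  set H₀ : ℂ → ℂ := fun s => mellinZ α s - ∑ a ∈ E, principal α B a s with hH₀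
  -- At a pole `H₀` has a meaningless default value; the punctured limit replaces it by the
  -- holomorphic continuation.
  set H : ℂ → ℂ := fun s => limUnder (𝓝[≠] s) H₀ with hH
  -- This line is to the right of 0 and of `m`, the largest possible staircase entry, hence of every
  -- pole.
  set σ : ℝ := |(m : ℝ)| + 1 with hσ
  have hN : (0 : ℝ) ≤ N := Nat.cast_nonneg N
  have hσ0 : 0 < σ := by positivity
  have hσm : (m : ℝ) < σ := by linarith [le_abs_self (m : ℝ)]
  have hσE : ∀ a ∈ E, 0 < σ + (a : ℝ) := by
    intro a ha
    rcases (mem_exponentsUpTo.1 ha).1 with h | h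
    · have : (0 : ℝ) ≤ a := by exact_mod_cast h
      linarith
    · have h1 : -m ≤ a := (Finset.mem_Icc.1 h).1
      have : -(m : ℝ) ≤ a := by exact_mod_cast h1
      linarith
  have hreg : ∀ s : ℂ, -B < s.re → (∀ a ∈ E, s ≠ -(a : ℂ)) → AnalyticAt ℂ H₀ s :=
    fun s h1 h2 => analyticAt_regularPart h1 h2
  have heq : ∀ s : ℂ, -B < s.re → (∀ a ∈ E, s ≠ -(a : ℂ)) → H s = H₀ s :=
    fun s h1 h2 => limUnder_eq_of_continuousAt (hreg s h1 h2).continuousAt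
  have han : ∀ s : ℂ, -B < s.re → AnalyticAt ℂ H s := by
    intro s hs
    by_cases h : ∀ a ∈ E, s ≠ -(a : ℂ)
    · exact analyticAt_limUnder (hreg s hs h) (EventuallyEq.refl _ _)
    · push Not at h
      obtain ⟨a, ha, rfl⟩ := h
      obtain ⟨g, hg, hev⟩ := exists_analyticAt_regularPart (B := B) ha (by simpa using hs)
      exact analyticAt_limUnder hg hev
  have hbound : ∃ C : ℝ, ∀ s : ℂ, -(N + 1 / 2 : ℝ) ≤ s.re → s.re ≤ σ → 1 ≤ |s.im| →
      ‖H s‖ ≤ C / s.im ^ 2 := by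
    obtain ⟨C, hC⟩ :=
      (polyBddOn_prod_zeta (staircase_im ℓ m) (-(N + 1 / 2 : ℝ)) σ).norm_Gamma_mul_le
    refine ⟨C + ∑ a ∈ E, (‖coeffC α a 0‖ * |B - a| + ‖coeffC α a 1‖), fun s h1 h2 h3 => ?_⟩
    have him := im_ne_zero_of_one_le_abs h3
    rw [heq s (by linarith) (fun a _ h => him (by rw [h]; simp)), add_div, Finset.sum_div]
    refine (norm_sub_le _ _).trans (add_le_add (hC s h1 h2 h3) ?_)
    exact (norm_sum_le _ _).trans (Finset.sum_le_sum fun a _ => norm_principal_le α B a him)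
  obtain ⟨C, hC⟩ := hbound
  refine ⟨H, fun x h0 h1 => ?_⟩
  have hshift : mellinInv (-(N + 1 / 2 : ℝ)) H x = mellinInv σ H x :=
    mellinInv_eq_mellinInv h0 (by linarith)
      (fun s hs => (han s (by linarith [hs.1])).differentiableAt.differentiableWithinAt) hC
  have hZ : Z α x = mellinInv σ (mellinZ α) x := by
    refine (hasSum_term hσ0 h0 fun j => ?_).tsum_eq
    rw [staircase_re]
    linarith [(Nat.cast_nonneg (j : ℕ) : (0 : ℝ) ≤ (j : ℕ))]
  have hline : mellinInv σ H x = mellinInv σ H₀ x := by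
    refine mellinInv_congr (fun y => heq _ (by simp; linarith) fun a ha h => ?_) x
    have := congrArg Complex.re h
    simp at this
    linarith [hσE a ha]
  have hpint : ∀ a ∈ E, Complex.VerticalIntegrable (principal α B a) σ := fun a ha =>
    verticalIntegrable_principal α (hσE a ha) (by linarith)
  have hsint : Complex.VerticalIntegrable (fun s => ∑ a ∈ E, principal α B a s) σ :=
    MeasureTheory.integrable_finsetSum _ hpint
  rw [hshift, hline, hH₀, mellinInv_sub (verticalIntegrable_mellinZ hσ0 hσm) hsint h0,
    mellinInv_sum _ hpint h0, ← hZ,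
    Finset.sum_congr rfl fun a ha => mellinInv_principal α (hσE a ha) (by linarith) h0 h1,
    sub_sub, Finset.sum_mul, ← Finset.sum_add_distrib]
  congr 1
  refine Finset.sum_congr rfl fun a _ => ?_
  rw [Finset.sum_pair zero_ne_one]
  ring

lemma isLittleO_rpow_of_lt {N : ℕ} {r : ℝ} (h : (N : ℝ) < r) :
    (fun t : ℝ => t ^ r) =o[𝓝[>] 0] fun t : ℝ => t ^ N := by
  refine (isLittleO_iff_tendsto' ?_).2 ?_
  · filter_upwards [self_mem_nhdsWithin] with t (ht : 0 < t) h0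
    exact absurd h0 (pow_pos ht N).ne'
  · have h1 : Tendsto (fun t : ℝ => t ^ (r - N)) (𝓝[>] 0) (𝓝 0) := by
      have := (Real.continuousAt_rpow_const 0 (r - N) (Or.inr (by linarith))).tendsto
      rw [Real.zero_rpow (by linarith)] at this
      exact this.mono_left nhdsWithin_le_nhds
    refine h1.congr' ?_
    filter_upwards [self_mem_nhdsWithin] with t (ht : 0 < t)
    rw [Real.rpow_sub ht, Real.rpow_natCast]

lemma isLittleO_remainder (ℓ : ℕ) (m : ℤ) (N : ℕ) :
    (fun t : ℝ => Z (staircase ℓ m) t - ∑ a ∈ exponentsUpTo ℓ m N, ∑ b ∈ ({0, 1} : Finset ℕ),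
      coeffC (staircase ℓ m) (a : ℂ) b * (t : ℂ) ^ a * ((-Real.log t : ℝ) : ℂ) ^ b)
      =o[𝓝[>] (0 : ℝ)] fun t : ℝ => t ^ N := by
  obtain ⟨H, hH⟩ := exists_mellinInv_remainder ℓ m N
  set K := ∑ a ∈ exponentsUpTo ℓ m N, coeffC (staircase ℓ m) (a : ℂ) 0
  have h1 : (fun t : ℝ => mellinInv (-(N + 1 / 2 : ℝ)) H t) =o[𝓝[>] (0 : ℝ)] fun t : ℝ => t ^ N := by
    refine IsBigO.trans_isLittleO ?_ (isLittleO_rpow_of_lt (r := N + 1 / 2) (by linarith))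
    refine IsBigO.of_bound
      (1 / (2 * Real.pi) * ∫ y : ℝ, ‖H ((-(N + 1 / 2 : ℝ) : ℝ) + y * Complex.I)‖) ?_
    filter_upwards [self_mem_nhdsWithin] with t (ht : 0 < t)
    rw [Real.norm_of_nonneg (Real.rpow_nonneg ht.le _)]
    simpa only [neg_neg] using norm_mellinInv_le H (-(N + 1 / 2 : ℝ)) ht
  have h2 : (fun t : ℝ => K * (t : ℂ) ^ ((N + 1 : ℝ) : ℂ)) =o[𝓝[>] (0 : ℝ)] fun t : ℝ => t ^ N := by
    refine IsBigO.trans_isLittleO ?_ (isLittleO_rpow_of_lt (r := N + 1) (by linarith))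
    refine IsBigO.of_bound ‖K‖ ?_
    filter_upwards [self_mem_nhdsWithin] with t (ht : 0 < t)
    rw [norm_mul, Complex.norm_cpow_eq_rpow_re_of_pos ht,
      Real.norm_of_nonneg (Real.rpow_nonneg ht.le _), Complex.ofReal_re]
  refine (h1.sub h2).congr' ?_ (EventuallyEq.refl _ _)
  filter_upwards [Ioo_mem_nhdsGT (show (0 : ℝ) < 1 by norm_num)] with t ht
  exact (hH t ht.1 ht.2).symm

/-! ### Reindexing products from `Fin ℓ` to `{1, …, ℓ}` -/

/-- The embedding `j ↦ j + 1` of `{0, …, ℓ - 1}` onto `{1, …, ℓ}`. -/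
def finSucc (ℓ : ℕ) : Fin ℓ ↪ ℤ :=
  ⟨fun j => (j : ℕ) + 1, fun i j h => Fin.ext (by simpa using h)⟩

lemma finSucc_apply {ℓ : ℕ} (j : Fin ℓ) : finSucc ℓ j = ((j : ℕ) : ℤ) + 1 := rfl

lemma map_finSucc (ℓ : ℕ) : Finset.univ.map (finSucc ℓ) = Finset.Icc (1 : ℤ) ℓ := by
  ext k
  simp only [Finset.mem_map, Finset.mem_univ, true_and, Finset.mem_Icc, finSucc_apply]
  constructor
  · rintro ⟨j, rfl⟩
    have := j.2
    omega
  · rintro ⟨h1, h2⟩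
    exact ⟨⟨(k - 1).toNat, by omega⟩, by simp; omega⟩

/-- The singular factor has index `a + m` when counted from 0, hence `a + m + 1` when counted from
1. -/
lemma map_finSucc_erase {ℓ : ℕ} {m a : ℤ} {i : Fin ℓ} (hi : ((i : ℕ) : ℤ) = a + m) :
    (Finset.univ.erase i).map (finSucc ℓ) = regularIdx ℓ m a := by
  rw [Finset.map_erase, map_finSucc, regularIdx, ← hi]
  rfl

lemma prod_map_finSucc {ℓ : ℕ} (m a : ℤ) (u : Finset (Fin ℓ)) :
    ∏ j ∈ u.map (finSucc ℓ), riemannZeta ((-a - m + j : ℤ) : ℂ) =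
      ∏ j ∈ u, riemannZeta (-(a : ℂ) + 1 - staircase ℓ m j) := by
  rw [Finset.prod_map]
  refine Finset.prod_congr rfl fun j _ => ?_
  rw [neg_add_one_sub_staircase]
  rfl

lemma Gamma_neg_intCast {a : ℤ} (ha : a < 0) :
    Complex.Gamma (-(a : ℂ)) = (((-a - 1).toNat ! : ℕ) : ℂ) := by
  rw [← Complex.Gamma_nat_eq_factorial]
  congr 1
  have : ((-a - 1).toNat : ℤ) = -a - 1 := Int.toNat_of_nonneg (by omega)
  have h2 : (((-a - 1).toNat : ℤ) : ℂ) = -a - 1 := by rw [this]; push_cast; ring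
  rw [Int.cast_natCast] at h2
  rw [h2]
  ring

end MultiZ

theorem mainTheorem6 (ℓ : ℕ) (hℓ : 1 ≤ ℓ) (m : ℤ) :
    -- the multiple series defining `Z_m^{[ℓ]}(t)` converges (absolutely) for every `t > 0`
    (∀ t : ℝ, 0 < t → Summable (MultiZ.term (MultiZ.staircase ℓ m) t)) ∧
    -- complete asymptotic expansion as `t → 0⁺`
    (∀ N : ℕ,
      (fun t : ℝ => MultiZ.Z (MultiZ.staircase ℓ m) t -
          ∑ a ∈ MultiZ.exponentsUpTo ℓ m N, ∑ b ∈ ({0, 1} : Finset ℕ),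
            MultiZ.coeffC (MultiZ.staircase ℓ m) (a : ℂ) b *
              (t : ℂ) ^ a * ((-Real.log t : ℝ) : ℂ) ^ b)
        =o[𝓝[>] (0 : ℝ)] (fun t : ℝ => t ^ N)) ∧
    -- coefficients for `a ∈ ℕ ∖ S_{ℓ,m}`
    (∀ a : ℕ, (a : ℤ) ∉ MultiZ.S ℓ m → ∀ b : ℕ,
      MultiZ.coeffC (MultiZ.staircase ℓ m) (a : ℂ) b =
        if b = 0 then
          (-1 : ℂ) ^ a / (a ! : ℂ) *
            ∏ j ∈ Finset.Icc (1 : ℤ) ℓ, riemannZeta ((-(a : ℤ) - m + j : ℤ) : ℂ)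
        else 0) ∧
    -- coefficients for `a ∈ S_{ℓ,m} ∖ ℕ`
    (∀ a : ℤ, a ∈ MultiZ.S ℓ m → a < 0 → ∀ b : ℕ,
      MultiZ.coeffC (MultiZ.staircase ℓ m) (a : ℂ) b =
        if b = 0 then
          (((-a - 1).toNat ! : ℕ) : ℂ) *
            ∏ j ∈ MultiZ.regularIdx ℓ m a, riemannZeta ((-a - m + j : ℤ) : ℂ)
        else 0) ∧
    -- coefficients for `a ∈ ℕ ∩ S_{ℓ,m}`
    (∀ a : ℕ, (a : ℤ) ∈ MultiZ.S ℓ m →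
      (MultiZ.coeffC (MultiZ.staircase ℓ m) (a : ℂ) 1 =
        (-1 : ℂ) ^ a / (a ! : ℂ) *
          ∏ j ∈ MultiZ.regularIdx ℓ m a, riemannZeta ((-(a : ℤ) - m + j : ℤ) : ℂ)) ∧
      (MultiZ.coeffC (MultiZ.staircase ℓ m) (a : ℂ) 0 =
        (-1 : ℂ) ^ a / (a ! : ℂ) *
          (((harmonic a : ℚ) : ℂ) *
              ∏ j ∈ MultiZ.regularIdx ℓ m a, riemannZeta ((-(a : ℤ) - m + j : ℤ) : ℂ) +
            ∑ j ∈ MultiZ.regularIdx ℓ m a,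
              deriv riemannZeta ((-(a : ℤ) - m + j : ℤ) : ℂ) *
                ∏ r ∈ (MultiZ.regularIdx ℓ m a).erase j,
                  riemannZeta ((-(a : ℤ) - m + r : ℤ) : ℂ))) ∧
      (∀ b : ℕ, 2 ≤ b → MultiZ.coeffC (MultiZ.staircase ℓ m) (a : ℂ) b = 0)) := by
  refine ⟨fun t ht => ?_, MultiZ.isLittleO_remainder ℓ m, fun a ha b => ?_, fun a hS ha b => ?_,
    fun a hS => ?_⟩
  · refine (MultiZ.hasSum_term (σ := |(m : ℝ)| + 1) (by positivity) ht fun j => ?_).summable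
    rw [MultiZ.staircase_re]
    linarith [le_abs_self (m : ℝ), (Nat.cast_nonneg (j : ℕ) : (0 : ℝ) ≤ (j : ℕ))]
  · have h : ∀ j, -((a : ℤ) : ℂ) + 1 - MultiZ.staircase ℓ m j ≠ 1 := fun j hj =>
      ha (MultiZ.mem_S_iff.2 ⟨j, MultiZ.neg_add_one_sub_staircase_eq_one.1 hj⟩)
    rw [MultiZ.coeffC_of_natCast (by simpa only [Int.cast_natCast] using h), ← MultiZ.map_finSucc,
      MultiZ.prod_map_finSucc, Int.cast_natCast]
  · obtain ⟨i, hi⟩ := MultiZ.mem_S_iff.1 hS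
    rw [MultiZ.coeffC_of_pole (MultiZ.intCast_ne_natCast ha)
      (MultiZ.neg_add_one_sub_staircase_eq_one.2 hi) (MultiZ.neg_add_one_sub_staircase_ne_one hi),
      ← MultiZ.map_finSucc_erase hi, MultiZ.prod_map_finSucc, MultiZ.Gamma_neg_intCast ha]
  · obtain ⟨i, hi⟩ := MultiZ.mem_S_iff.1 hS
    have h1 := MultiZ.neg_add_one_sub_staircase_eq_one.2 hi
    have h2 := MultiZ.neg_add_one_sub_staircase_ne_one hi
    rw [Int.cast_natCast] at h1
    simp only [Int.cast_natCast] at h2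
    obtain ⟨hC1, hC0, hC⟩ := MultiZ.coeffC_of_natCast_of_pole h1 h2
    refine ⟨?_, ?_, hC⟩
    · rw [hC1, ← MultiZ.map_finSucc_erase hi, MultiZ.prod_map_finSucc, Int.cast_natCast]
    · rw [hC0, ← MultiZ.map_finSucc_erase hi, MultiZ.prod_map_finSucc, Finset.sum_map,
        Int.cast_natCast]
      refine congrArg (_ * ·) (congrArg (_ + ·) (Finset.sum_congr rfl fun j _ => ?_))
      rw [← Finset.map_erase, MultiZ.prod_map_finSucc, Int.cast_natCast]
      congr 2
      have := MultiZ.neg_add_one_sub_staircase ℓ m a j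
      rw [Int.cast_natCast] at this
      rw [this]
      rfl
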